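/- A \emph{finite deterministic dynamical system} (FDDS) is a finite set with a map to itself. FDDSs up to isomorphism form a commutative semiring $\mathbb D$ with disjoint union as sum and direct product as product; $|A|$ denotes the number of states of $A$, and $A\le B$ means that $A+D=B$ for some $D\in\mathbb D$, in which case we write $D=B-A$. A \emph{permutation} is an element of $\mathbb D$ whose map is bijective, that is, a sum of cycles. For $F:\mathbb D\to\mathbb D$ and a permutation $B$, the \emph{greedy algorithm} for $F(X)=B$ is the following. Start with $X=\mathbf 0$. If $F(X)=B$, return $X$. If $|F(X)|>|B|$ or $F(X)\not\le B$, answer that there is no solution. Otherwise add to $X$ one copy of the shortest cycle of $B-F(X)$, and repeat. \textbf{(1) Roots (Algorithm 1).} Let $k>0$ be an integer and let $B$ be a permutation. The greedy algorithm for $X^k=B$ has exactly one run and halts. If it returns $X$, then $X$ is the unique element of $\mathbb D$ with $X^k=B$; if it answers that there is no solution, then no $X\in\mathbb D$ satisfies $X^k=B$. The algorithm runs in polynomial time: there is a Turing machine that, on input $k$ (in binary) and an explicit graph of $B$, outputs in time polynomial in the length of the input the successive values of $X$ in this run, as explicit graphs, together with its result. The machine and the polynomial do not depend on $k$ and $B$.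 \textbf{(2) Injective polynomials (Algorithm 2).} Let $P=\sum_j A_jX^j$ be a polynomial whose coefficients $A_j$ are permutations and which is injective as a function on the permutations, and let $B$ be a permutation. The greedy algorithm for $P(X)=B$ has exactly one run and halts. If it returns $X$, then $X$ is the unique element of $\mathbb D$ with $P(X)=B$; if it answers that there is no solution, then no $X\in\mathbb D$ satisfies $P(X)=B$. The algorithm runs in polynomial time: there is a Turing machine that, on input $P$ (as a list of monomials, with exponents in binary and coefficients as explicit graphs) and an explicit graph of $B$, outputs in time polynomial in the length of the input the successive values of $X$ in this run, as explicit graphs, together with its result. The machine and the polynomial time bound do not depend on $P$ and $B$. Here the explicit graph of a permutation with $n$ states is the table of the successors of the states $0,\dots,n-1$, written in unary, so that its length is of order $n^2$. -/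

import Mathlib

/-- A finite deterministic dynamical system: a finite set of states with a transition function. -/
structure FDDS : Type 1 where
  State : Type
  finite : Finite State
  map : State → State

namespace FDDS

/-- Isomorphism of systems: a bijection of the states that commutes with the transitions. -/
def Iso (A B : FDDS) : Prop :=
  ∃ e : A.State ≃ B.State, ∀ x, e (A.map x) = B.map (e x)

theorem Iso.refl (A : FDDS) : Iso A A := ⟨Equiv.refl _, fun _ => rfl⟩

theorem Iso.symm {A B : FDDS} : Iso A B → Iso B A := by
  rintro ⟨e, h⟩
  exact ⟨e.symm, fun x => by rw [Equiv.symm_apply_eq, h, Equiv.apply_symm_apply]⟩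

theorem Iso.trans {A B C : FDDS} : Iso A B → Iso B C → Iso A C := by
  rintro ⟨e, h⟩ ⟨e', h'⟩
  exact ⟨e.trans e', fun x => by simp [h, h']⟩

instance setoid : Setoid FDDS := ⟨Iso, Iso.refl, Iso.symm, Iso.trans⟩

/-- Alternative execution: disjoint union. -/
def add (A B : FDDS) : FDDS where
  State := A.State ⊕ B.State
  finite := by have := A.finite; have := B.finite; infer_instance
  map := Sum.map A.map B.map

/-- Synchronous parallel execution: direct product. -/
def mul (A B : FDDS) : FDDS where
  State := A.State × B.State
  finite := by have := A.finite; have := B.finite; infer_instance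
  map := Prod.map A.map B.map

/-- The empty system. -/
def empty : FDDS := ⟨Empty, inferInstance, id⟩

/-- A single fixed point. -/
def point : FDDS := ⟨Unit, inferInstance, id⟩

end FDDS

/-- The semiring of finite deterministic dynamical systems up to isomorphism. -/
def Dyn : Type 1 := Quotient FDDS.setoid

namespace Dyn

/-- The isomorphism class of a system. -/
def mk (A : FDDS) : Dyn := Quotient.mk _ A

protected def add : Dyn → Dyn → Dyn :=
  Quotient.map₂ FDDS.add (by
    rintro A A' ⟨e, h⟩ B B' ⟨e', h'⟩
    refine ⟨Equiv.sumCongr e e', ?_⟩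
    rintro (x | x)
    · exact congrArg Sum.inl (h x)
    · exact congrArg Sum.inr (h' x))

protected def mul : Dyn → Dyn → Dyn :=
  Quotient.map₂ FDDS.mul (by
    rintro A A' ⟨e, h⟩ B B' ⟨e', h'⟩
    refine ⟨Equiv.prodCongr e e', ?_⟩
    rintro ⟨x, y⟩
    exact congrArg₂ Prod.mk (h x) (h' y))

instance : Add Dyn := ⟨Dyn.add⟩
instance : Mul Dyn := ⟨Dyn.mul⟩
instance : Zero Dyn := ⟨mk FDDS.empty⟩
instance : One Dyn := ⟨mk FDDS.point⟩

protected theorem add_assoc' (a b c : Dyn) : a + b + c = a + (b + c) := by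
  induction a using Quotient.inductionOn
  induction b using Quotient.inductionOn
  induction c using Quotient.inductionOn
  refine Quotient.sound ⟨Equiv.sumAssoc _ _ _, ?_⟩
  rintro ((x | x) | x) <;> rfl

protected theorem add_comm' (a b : Dyn) : a + b = b + a := by
  induction a using Quotient.inductionOn
  induction b using Quotient.inductionOn
  refine Quotient.sound ⟨Equiv.sumComm _ _, ?_⟩
  rintro (x | x) <;> rfl

protected theorem zero_add' (a : Dyn) : 0 + a = a := by
  induction a using Quotient.inductionOn
  refine Quotient.sound ⟨Equiv.emptySum Empty _, ?_⟩
  rintro (x | x)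
  · exact x.elim
  · rfl

protected theorem mul_assoc' (a b c : Dyn) : a * b * c = a * (b * c) := by
  induction a using Quotient.inductionOn
  induction b using Quotient.inductionOn
  induction c using Quotient.inductionOn
  exact Quotient.sound ⟨Equiv.prodAssoc _ _ _, fun _ => rfl⟩

protected theorem mul_comm' (a b : Dyn) : a * b = b * a := by
  induction a using Quotient.inductionOn
  induction b using Quotient.inductionOn
  exact Quotient.sound ⟨Equiv.prodComm _ _, fun _ => rfl⟩

protected theorem one_mul' (a : Dyn) : 1 * a = a := by
  induction a using Quotient.inductionOn
  exact Quotient.sound ⟨Equiv.punitProd _, fun _ => rfl⟩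

protected theorem zero_mul' (a : Dyn) : 0 * a = 0 := by
  induction a using Quotient.inductionOn
  exact Quotient.sound ⟨Equiv.emptyProd _, fun x => x.1.elim⟩

protected theorem add_mul' (a b c : Dyn) : (a + b) * c = a * c + b * c := by
  induction a using Quotient.inductionOn
  induction b using Quotient.inductionOn
  induction c using Quotient.inductionOn
  refine Quotient.sound ⟨Equiv.sumProdDistrib _ _ _, ?_⟩
  rintro ⟨x | x, y⟩ <;> rfl

instance : CommSemiring Dyn where
  add_assoc := Dyn.add_assoc'
  add_comm := Dyn.add_comm'
  zero_add := Dyn.zero_add'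
  add_zero a := by rw [Dyn.add_comm', Dyn.zero_add']
  mul_assoc := Dyn.mul_assoc'
  mul_comm := Dyn.mul_comm'
  one_mul := Dyn.one_mul'
  mul_one a := by rw [Dyn.mul_comm', Dyn.one_mul']
  zero_mul := Dyn.zero_mul'
  mul_zero a := by rw [Dyn.mul_comm', Dyn.zero_mul']
  right_distrib := Dyn.add_mul'
  left_distrib a b c := by
    rw [Dyn.mul_comm', Dyn.add_mul', Dyn.mul_comm' b, Dyn.mul_comm' c]
  nsmul := nsmulRec

/-- The number of states. -/
noncomputable def size : Dyn → ℕ :=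
  Quotient.lift (fun A : FDDS => Nat.card A.State) (by
    rintro A B ⟨e, -⟩
    exact Nat.card_congr e)

/-- A permutation: every state lies on a cycle, i.e. the transition function is bijective. -/
def IsPermutation : Dyn → Prop :=
  Quotient.lift (fun A : FDDS => Function.Bijective A.map) (by
    rintro A B ⟨e, h⟩
    have hB : B.map = e ∘ A.map ∘ e.symm := by
      funext x
      simp [h]
    simp [hB])

/-- `A.HasCycle p`: the system has a cycle of length `p`, that is, a state that returns to itself
for the first time after `p > 0` steps. -/
def HasCycle : Dyn → ℕ → Prop :=
  Quotient.lift (fun (A : FDDS) (p : ℕ) => 0 < p ∧ ∃ x, Function.minimalPeriod A.map x = p) (by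
    have key : ∀ A B : FDDS, FDDS.Iso A B → ∀ p,
        (∃ x, Function.minimalPeriod A.map x = p) → ∃ x, Function.minimalPeriod B.map x = p := by
      rintro A B ⟨e, h⟩ p ⟨x, rfl⟩
      refine ⟨e x, Function.minimalPeriod_eq_minimalPeriod_iff.2 fun n => ?_⟩
      have hs : Function.Semiconj e A.map B.map := h
      simp [Function.IsPeriodicPt, Function.IsFixedPt, ← (hs.iterate_right n).eq]
    intro A B h
    funext p
    exact propext (and_congr_right fun _ => ⟨key A B h p, key B A h.symm p⟩))

/-- The cycle of length `p`. -/
def cycle (p : ℕ) : Dyn := mk ⟨Fin p, inferInstance, finRotate p⟩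

/-- The runs of the greedy algorithm for the equation `F X = B`. `GreedyRun F B X Xs r` says that,
started with the current value `X`, the variable of the algorithm takes the successive values `Xs`
(the first one is `X`), and that the algorithm then stops with the result `r`: either it returns a
system, or (`none`) it answers that the equation has no solution. -/
inductive GreedyRun (F : Dyn → Dyn) (B : Dyn) : Dyn → List Dyn → Option Dyn → Prop
  /-- Nothing is left in `B - F X`: return `X`. -/
  | accept (X : Dyn) : F X = B → GreedyRun F B X [X] (some X)
  /-- `F X` has become too large, or is not a submultiset of `B`: there is no solution. -/
  | reject (X : Dyn) : (B.size < (F X).size ∨ ¬ ∃ D, F X + D = B) → GreedyRun F B X [X] none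
  /-- `D = B - F X` is defined and `p` is the length of its shortest cycle: add this cycle. -/
  | step (X D : Dyn) (p : ℕ) (Xs : List Dyn) (r : Option Dyn) :
      F X + D = B → IsLeast {q | D.HasCycle q} p →
      GreedyRun F B (X + cycle p) Xs r → GreedyRun F B X (X :: Xs) r

end Dyn

/-- A permutation given explicitly as a graph on the states `0, ..., n - 1`. -/
abbrev PermGraph : Type := Σ n : ℕ, Equiv.Perm (Fin n)

/-- The system that a graph describes. -/
def PermGraph.toDyn (G : PermGraph) : Dyn := Dyn.mk ⟨Fin G.1, inferInstance, G.2⟩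

/-- A polynomial over the permutations, given by a list of monomials
(exponent, coefficient). -/
abbrev PermPoly : Type := List (ℕ × PermGraph)

/-- The polynomial that a list of monomials describes. -/
noncomputable def PermPoly.toPolynomial (P : PermPoly) : Polynomial Dyn :=
  (P.map fun m => Polynomial.monomial m.1 m.2.toDyn).sum

/-- Injectivity as a function on the permutations. -/
def InjectiveOnPermutations (P : Polynomial Dyn) : Prop :=
  Set.InjOn (fun X => P.eval X) {X | X.IsPermutation}

/-- The alphabet for inputs and outputs of Turing machines. -/
inductive Symb : Type
  | zero | one | sep | mark | close
  deriving DecidableEq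

instance : Fintype Symb :=
  ⟨{Symb.zero, Symb.one, Symb.sep, Symb.mark, Symb.close}, fun x => by cases x <;> decide⟩

/-- A number in binary (least significant bit first), with an end marker. -/
def encodeBinary (k : ℕ) : List Symb :=
  (Computability.encodeNat k).map (fun b => if b then Symb.one else Symb.zero) ++ [Symb.close]

/-- A graph on `n` states as the table of the successors of `0, ..., n - 1`, where the successor
`j` is written as `j` strokes and a separator. For a permutation of `n` states the length of this
word is `n * (n + 1) / 2 + 1`. -/
def encodeGraph (G : PermGraph) : List Symb :=
  (List.finRange G.1).flatMap (fun i => List.replicate (G.2 i : ℕ) Symb.one ++ [Symb.sep]) ++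
    [Symb.close]

/-- A list, each item preceded by a mark, with an end marker. -/
def encodeList {α : Type} (enc : α → List Symb) (l : List α) : List Symb :=
  l.flatMap (fun a => Symb.mark :: enc a) ++ [Symb.close]

/-- The inputs `(k, B)` of the root problem: an exponent `k > 0` and a permutation. -/
abbrev RootInput : Type := {k : ℕ // 0 < k} × PermGraph

/-- The exponent in binary, then the graph. -/
def encodeRootInput (i : RootInput) : List Symb :=
  encodeBinary i.1 ++ encodeGraph i.2

/-- The inputs `(P, B)` of the equation problem: an injective polynomial over the permutations and
a permutation. -/
abbrev EquationInput : Type :=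
  {P : PermPoly // InjectiveOnPermutations P.toPolynomial} × PermGraph

/-- The list of monomials (exponents in binary, coefficients as graphs), then the graph of the
constant side. -/
def encodeEquationInput (i : EquationInput) : List Symb :=
  encodeList (fun m : ℕ × PermGraph => encodeBinary m.1 ++ encodeGraph m.2) i.1.1 ++
    encodeGraph i.2

/-- A record of a run: the successive values of the variable, and the result. -/
abbrev RunRecord : Type := List PermGraph × Option PermGraph

/-- The successive values as graphs; then the returned graph, or a single symbol for the answer
that there is no solution. -/
def encodeRunRecord (t : RunRecord) : List Symb :=
  encodeList encodeGraph t.1 ++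
    match t.2 with
    | none => [Symb.zero]
    | some G => Symb.one :: encodeGraph G

/-- `t` records a run of the greedy algorithm for `F X = B`, started with `X = 0`. -/
def RecordsRun (F : Dyn → Dyn) (B : Dyn) (t : RunRecord) : Prop :=
  Dyn.GreedyRun F B 0 (t.1.map PermGraph.toDyn) (t.2.map PermGraph.toDyn)

/-! Let `fixCount d A` be the number of states of `A` that return to themselves after `d` steps.
Each `fixCount d` is a semiring homomorphism to the natural numbers. For `d > 0` it is the sum of
`cycleCount c` over the divisors `c` of `d` (`fixCount_eq_sum`), so these numbers determine a
permutation, and the length of its shortest cycle is the least `d > 0` at which they do not vanish.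

Suppose that a nonconstant coefficient of `P` has a fixed point (`HasFixingCoeff`), as for `X ^ k`.
That coefficient is then positive under every `fixCount d`, so `fixCount d (P X)` is a strictly
increasing function of `fixCount d X`. If `P (X + Z) = B` and `P X + D = B`, it follows that `D` and
`Z` have positive `fixCount d` for the same `d`, hence shortest cycles of equal length
(`HasFixingCoeff.isLeast_iff`). The cycle that the algorithm adds is therefore a summand of `Z`, and
the value of the variable remains a summand of the solution (`HasFixingCoeff.run_eq_some`). The run
ends because `P X` grows strictly.

Injectivity forces such a coefficient. Otherwise all short cycles in the nonconstant coefficients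
have lengths in a finite range starting at `2`, and `separatingPair` gives two distinct permutations
that agree under `fixCount d` whenever a length in that range divides `d`. For the other `d > 0` the
nonconstant coefficients contribute nothing, so `P` takes the same value at both.

For the running time, `P X` is never built, since exponents are binary. Only the numbers `fixCount d
(P X)` with `d ≤ |B|` are computed, with powers truncated at `|B| + 1`; this is exact as long as `P
X` is not too large (`evalFix_eq`). Since `|X| ≤ |P X|`, at most `|B| + 1` rounds occur. Polynomial
time is proved by closure properties of `Feasible`: its programs exist for every placement of the
variables and every first free stack, so they combine without renaming, and loops are allowed once
the accumulator is polynomially bounded. Programs become Turing machines whose labels are lists of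
remaining programs (`machine_reaches`). -/

/-! ### Structured programs over stacks and their compilation to Turing machines -/

/-- Structured programs over stacks of symbols, indexed by natural numbers. -/
inductive StackProg
  | skip
  | push (k : ℕ) (s : Symb)
  | seq (P Q : StackProg)
  | case (k : ℕ) (b : Option Symb → StackProg)
  | loop (k : ℕ) (b : Symb → StackProg)

namespace StackProg

open Function Turing

/-- `Exec P S S' t`: the program `P` transforms the stacks `S` into `S'` in `t` steps. A `case` pops
a stack and branches on the result; a `loop` pops a stack and runs its body until the stack is
found empty. -/
inductive Exec : StackProg → (ℕ → List Symb) → (ℕ → List Symb) → ℕ → Prop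
  | skip (S) : Exec skip S S 1
  | push (k s S) : Exec (push k s) S (update S k (s :: S k)) 1
  | seq {P Q S S' S'' t t'} : Exec P S S' t → Exec Q S' S'' t' → Exec (seq P Q) S S'' (t' + t + 1)
  | case {k b S S' t} : Exec (b (S k).head?) (update S k (S k).tail) S' t →
      Exec (case k b) S S' (t + 1)
  | loop_nil {k b S} : S k = [] → Exec (loop k b) S S 1
  | loop_cons {k b S S' S'' s r t t'} : S k = s :: r → Exec (b s) (update S k r) S' t →
      Exec (loop k b) S' S'' t' → Exec (loop k b) S S'' (t' + t + 1)

/-- All stacks that the program uses have indices at most `N`. -/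
def UsesOnly (N : ℕ) : StackProg → Prop
  | skip => True
  | push k _ => k ≤ N
  | seq P Q => P.UsesOnly N ∧ Q.UsesOnly N
  | case k b => k ≤ N ∧ ∀ o, (b o).UsesOnly N
  | loop k b => k ≤ N ∧ ∀ s, (b s).UsesOnly N

theorem UsesOnly.mono {M N : ℕ} (h : M ≤ N) {P : StackProg} (hP : P.UsesOnly M) :
    P.UsesOnly N := by
  induction P with
  | skip => trivial
  | push k s => exact le_trans hP h
  | seq P Q ihP ihQ => exact ⟨ihP hP.1, ihQ hP.2⟩
  | case k b ih => exact ⟨hP.1.trans h, fun o => ih o (hP.2 o)⟩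
  | loop k b ih => exact ⟨hP.1.trans h, fun s => ih s (hP.2 s)⟩

theorem exists_usesOnly (P : StackProg) : ∃ N, P.UsesOnly N := by
  induction P with
  | skip => exact ⟨0, trivial⟩
  | push k s => exact ⟨k, le_refl k⟩
  | seq P Q ihP ihQ =>
    obtain ⟨M, hM⟩ := ihP
    obtain ⟨N, hN⟩ := ihQ
    exact ⟨max M N, hM.mono (le_max_left _ _), hN.mono (le_max_right _ _)⟩
  | case k b ih =>
    choose f hf using ih
    obtain ⟨M, hM⟩ := (Set.finite_range f).bddAbove
    exact ⟨max k M, le_max_left _ _, fun o =>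
      (hf o).mono ((hM ⟨o, rfl⟩).trans (le_max_right _ _))⟩
  | loop k b ih =>
    choose f hf using ih
    obtain ⟨M, hM⟩ := (Set.finite_range f).bddAbove
    exact ⟨max k M, le_max_left _ _, fun o =>
      (hf o).mono ((hM ⟨o, rfl⟩).trans (le_max_right _ _))⟩

/-- The list of programs that remain to be run, after one step of the first of them, in which the
symbol `o` was popped. -/
def next : List StackProg → Option Symb → List StackProg
  | [], _ => []
  | skip :: κ, _ => κ
  | push _ _ :: κ, _ => κ
  | seq P Q :: κ, _ => P :: Q :: κ
  | case _ b :: κ, o => b o :: κ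
  | loop _ _ :: κ, none => κ
  | loop k b :: κ, some s => b s :: loop k b :: κ

/-- The control points of a program followed by the programs `κ`. -/
def points : StackProg → List StackProg → Set (List StackProg)
  | skip, κ => {skip :: κ}
  | push k s, κ => {push k s :: κ}
  | seq P Q, κ => {seq P Q :: κ} ∪ points P (Q :: κ) ∪ points Q κ
  | case k b, κ => {case k b :: κ} ∪ ⋃ o, points (b o) κ
  | loop k b, κ => {loop k b :: κ} ∪ ⋃ s, points (b s) (loop k b :: κ)

/-- The body of a loop is continued by the loop itself and not by an unrolled copy, so the recursion
is structural. Finiteness is what makes these lists usable as labels of a machine. -/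
theorem finite_points (P : StackProg) (κ : List StackProg) : (points P κ).Finite := by
  induction P generalizing κ with
  | skip => exact Set.finite_singleton _
  | push k s => exact Set.finite_singleton _
  | seq P Q ihP ihQ => exact ((Set.finite_singleton _).union (ihP _)).union (ihQ _)
  | case k b ih => exact (Set.finite_singleton _).union (Set.finite_iUnion fun o => ih o _)
  | loop k b ih => exact (Set.finite_singleton _).union (Set.finite_iUnion fun o => ih o _)

theorem cons_mem_points (P : StackProg) (κ : List StackProg) : P :: κ ∈ points P κ := by
  cases P <;> simp [points]

/-- Control can leave the points of `P` only by reaching the continuation `κ`. With `κ = []` this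
closes the labels of the machine under successors. -/
theorem next_mem_points (P : StackProg) (κ : List StackProg) {l : List StackProg}
    (hl : l ∈ points P κ) (o : Option Symb) : next l o ∈ insert κ (points P κ) := by
  induction P generalizing κ with
  | skip => rw [points, Set.mem_singleton_iff] at hl; subst hl; exact Set.mem_insert _ _
  | push k s => rw [points, Set.mem_singleton_iff] at hl; subst hl; exact Set.mem_insert _ _
  | seq P Q ihP ihQ =>
    rcases hl with (hl | hl) | hl
    · rw [Set.mem_singleton_iff] at hl
      subst hl
      exact Or.inr (Or.inl (Or.inr (cons_mem_points _ _)))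
    · rcases ihP _ hl with h | h
      · exact Or.inr (Or.inr (h ▸ cons_mem_points _ _))
      · exact Or.inr (Or.inl (Or.inr h))
    · rcases ihQ _ hl with h | h
      · exact Or.inl h
      · exact Or.inr (Or.inr h)
  | case k b ih =>
    rcases hl with hl | hl
    · rw [Set.mem_singleton_iff] at hl
      subst hl
      exact Or.inr (Or.inr (Set.mem_iUnion.2 ⟨o, cons_mem_points _ _⟩))
    · obtain ⟨o', hl⟩ := Set.mem_iUnion.1 hl
      rcases ih _ _ hl with h | h
      · exact Or.inl h
      · exact Or.inr (Or.inr (Set.mem_iUnion.2 ⟨o', h⟩))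
  | loop k b ih =>
    rcases hl with hl | hl
    · rw [Set.mem_singleton_iff] at hl
      subst hl
      cases o with
      | none => exact Or.inl rfl
      | some s => exact Or.inr (Or.inr (Set.mem_iUnion.2 ⟨s, cons_mem_points _ _⟩))
    · obtain ⟨o', hl⟩ := Set.mem_iUnion.1 hl
      rcases ih _ _ hl with h | h
      · exact Or.inr (h ▸ Or.inl rfl)
      · exact Or.inr (Or.inr (Set.mem_iUnion.2 ⟨o', h⟩))

/-- The labels of the machine for `P`. -/
def Label (P : StackProg) : Type := (insert [] (points P []) : Set (List StackProg))

noncomputable instance (P : StackProg) : Fintype (Label P) :=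
  ((finite_points P []).insert []).fintype

/-- The successor of a label. -/
def Label.next {P : StackProg} (l : Label P) (o : Option Symb) : Label P :=
  ⟨StackProg.next l.1 o, by
    rcases l.2 with h | h
    · rw [h]; exact Or.inl rfl
    · exact next_mem_points P [] h o⟩

/-- The statement of the machine at a label. -/
def stmt (P : StackProg) (N : ℕ) (l : Label P) :
    TM2.Stmt (fun _ : Fin (N + 1) => Symb) (Label P) (Option Symb) :=
  match l.1 with
  -- `haltList` prescribes the initial internal state, so it is restored before halting.
  | [] => .load (fun _ => none) .halt
  | push k s :: _ => .push (Fin.ofNat (N + 1) k) (fun _ => s) (.goto l.next)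
  | case k _ :: _ => .pop (Fin.ofNat (N + 1) k) (fun _ o => o) (.goto l.next)
  | loop k _ :: _ => .pop (Fin.ofNat (N + 1) k) (fun _ o => o) (.goto l.next)
  | skip :: _ => .goto l.next
  | seq _ _ :: _ => .goto l.next

/-- The machine that runs `P`. -/
noncomputable def machine (P : StackProg) (N : ℕ) : FinTM2 where
  K := Fin (N + 1)
  k₀ := 0
  k₁ := Fin.ofNat (N + 1) 1
  Γ := fun _ => Symb
  Λ := Label P
  main := ⟨[P], Or.inr (cons_mem_points P [])⟩
  σ := Option Symb
  initialState := none
  Γk₀Fin := inferInstanceAs (Fintype Symb)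
  m := stmt P N

theorem update_comp_val {N k : ℕ} (hk : k ≤ N) (S : ℕ → List Symb) (x : List Symb) :
    (fun j : Fin (N + 1) => update S k x j) =
      update (fun j : Fin (N + 1) => S j) (Fin.ofNat (N + 1) k) x := by
  have h : ((Fin.ofNat (N + 1) k : Fin (N + 1)) : ℕ) = k := Nat.mod_eq_of_lt (by omega)
  funext j
  by_cases hj : j = Fin.ofNat (N + 1) k
  · subst hj
    rw [h, update_self, update_self]
  · rw [update_of_ne hj, update_of_ne]
    intro h'
    exact hj (Fin.ext (h'.trans h.symm))

/-- The configuration of the machine with given label, state and stacks. -/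
def cfg (P : StackProg) (N : ℕ) (l : Label P) (v : Option Symb) (S : ℕ → List Symb) :
    TM2.Cfg (fun _ : Fin (N + 1) => Symb) (Label P) (Option Symb) :=
  ⟨some l, v, fun j => S j⟩

/-- Induction on the execution. The continuation and the internal state are arbitrary because the
induction hypotheses are applied in the middle of larger programs, after symbols have been popped.
-/
theorem machine_reaches {P : StackProg} {N : ℕ} {Q : StackProg} {S S' : ℕ → List Symb} {t : ℕ}
    (h : Exec Q S S' t) (hQ : Q.UsesOnly N) :
    ∀ (κ : List StackProg) (l : Label P), l.1 = Q :: κ → ∀ v, ∃ (l' : Label P) (v' : Option Symb),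
      l'.1 = κ ∧
      (flip bind (TM2.step (stmt P N)))^[t] (some (cfg P N l v S)) = some (cfg P N l' v' S') := by
  induction h with
  | skip S =>
    intro κ l hl v
    refine ⟨l.next v, v, by simp [Label.next, hl, next], ?_⟩
    simp [flip, cfg, stmt, hl]
  | push k s S =>
    intro κ l hl v
    refine ⟨l.next v, v, by simp [Label.next, hl, next], ?_⟩
    simp [flip, cfg, stmt, hl, update_comp_val (show k ≤ N from hQ),
      Nat.mod_eq_of_lt (Nat.lt_succ_of_le (show k ≤ N from hQ))]
  | @seq Q₁ Q₂ S S' S'' t t' _ _ ih₁ ih₂ =>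
    intro κ l hl v
    obtain ⟨l₁, v₁, hl₁, h₁⟩ := ih₁ hQ.1 (Q₂ :: κ) (l.next v) (by simp [Label.next, hl, next]) v
    obtain ⟨l₂, v₂, hl₂, h₂⟩ := ih₂ hQ.2 κ l₁ hl₁ v₁
    refine ⟨l₂, v₂, hl₂, ?_⟩
    rw [iterate_succ_apply, iterate_add_apply, ← h₂, ← h₁]
    simp [flip, cfg, stmt, hl]
  | @case k b S S' t _ ih =>
    intro κ l hl v
    obtain ⟨l₁, v₁, hl₁, h₁⟩ := ih (hQ.2 _) κ (l.next (S k).head?)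
      (by simp [Label.next, hl, next]) (S k).head?
    refine ⟨l₁, v₁, hl₁, ?_⟩
    rw [iterate_succ_apply, ← h₁]
    simp [flip, cfg, stmt, hl, update_comp_val hQ.1, Nat.mod_eq_of_lt (Nat.lt_succ_of_le hQ.1)]
  | @loop_nil k b S h =>
    intro κ l hl v
    refine ⟨l.next none, none, by simp [Label.next, hl, next], ?_⟩
    -- The machine updates the stack even when it pops an empty one, so `S` is written as an update
    -- by its own value.
    have h' : (fun j : Fin (N + 1) => S j) = fun j : Fin (N + 1) => update S k [] j := by
      rw [← h, update_eq_self]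
    simp only [cfg]
    rw [h', update_comp_val hQ.1]
    simp [flip, stmt, hl]
  | @loop_cons k b S S' S'' s r t t' h _ _ ih₁ ih₂ =>
    intro κ l hl v
    obtain ⟨l₁, v₁, hl₁, h₁⟩ := ih₁ (hQ.2 _) (loop k b :: κ) (l.next (some s))
      (by simp [Label.next, hl, next]) (some s)
    obtain ⟨l₂, v₂, hl₂, h₂⟩ := ih₂ hQ κ l₁ hl₁ v₁
    refine ⟨l₂, v₂, hl₂, ?_⟩
    rw [iterate_succ_apply, iterate_add_apply, ← h₂, ← h₁]
    simp [flip, cfg, stmt, hl, h, update_comp_val hQ.1, Nat.mod_eq_of_lt (Nat.lt_succ_of_le hQ.1)]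

/-- A program that turns the encoding of every input on stack `0` into the encoding of the output
on stack `1` in polynomial time yields a polynomial time machine. -/
theorem computableInPolyTime {α β : Type} (ea : α → List Symb) (eb : β → List Symb) (f : α → β)
    (P : StackProg) (p : Polynomial ℕ)
    (h : ∀ a, ∃ t ≤ p.eval (ea a).length,
      Exec P (update (fun _ => []) 0 (ea a)) (update (fun _ => []) 1 (eb (f a))) t) :
    Nonempty (TM2ComputableInPolyTime ea eb f) := by
  obtain ⟨N, hN⟩ := P.exists_usesOnly
  -- Raising the bound ensures that there are at least two stacks, so `Fin.ofNat` does not identify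
  -- the output stack with the input stack.
  have hN' : P.UsesOnly (N + 1) := hN.mono (Nat.le_succ N)
  refine ⟨⟨⟨machine P (N + 1), Equiv.refl Symb, Equiv.refl Symb⟩, p + 1, fun a => ?_⟩⟩
  choose t ht hex using h a
  -- The additional step is the halting step at the empty label.
  refine ⟨⟨t + 1, ?_⟩, by simpa using ht⟩
  have key : ∃ (l' : Label P) (v' : Option Symb), l'.1 = [] ∧ _ :=
    machine_reaches hex hN' [] (machine P (N + 1)).main rfl none
  obtain ⟨l', v', hl', hrun⟩ := key
  have hin : initList (machine P (N + 1)) (List.map (Equiv.refl Symb).invFun (ea a)) =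
      cfg P (N + 1) (machine P (N + 1)).main none (update (fun _ => []) 0 (ea a)) := by
    unfold initList cfg
    congr 1
    funext (j : Fin (N + 2))
    by_cases hj : j = (0 : Fin (N + 2))
    · subst hj
      simp [machine]
      rfl
    · have : (j : ℕ) ≠ 0 := fun h => hj (Fin.ext h)
      rw [update_of_ne this]
      exact dif_neg hj
  have hout : haltList (machine P (N + 1)) (List.map (Equiv.refl Symb).invFun (eb (f a))) =
      ⟨none, none, fun j : Fin (N + 2) => update (fun _ => []) 1 (eb (f a)) (j : ℕ)⟩ := by
    unfold haltList
    congr 1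
    funext (j : Fin (N + 2))
    by_cases hj : j = (1 : Fin (N + 2))
    · subst hj
      refine (dif_pos rfl).trans ?_
      exact List.map_id (eb (f a))
    · have : (j : ℕ) ≠ 1 := fun h => hj (Fin.ext (by simpa using h))
      rw [update_of_ne this]
      exact dif_neg hj
  have step_last : (TM2.step (stmt P (N + 1))) (cfg P (N + 1) l' v'
      (update (fun _ => []) 1 (eb (f a)))) = some ⟨none, none, fun j : Fin (N + 2) =>
        update (fun _ => []) 1 (eb (f a)) (j : ℕ)⟩ := by
    simp [cfg, stmt, hl']
  have e1 : Option.map (haltList (machine P (N + 1)))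
      (some (List.map (Equiv.refl Symb).invFun (eb (f a)))) = some ⟨none, none,
        fun j : Fin (N + 2) => update (fun _ => []) 1 (eb (f a)) (j : ℕ)⟩ := congrArg some hout
  rw [iterate_succ_apply']
  refine Eq.trans ?_ e1.symm
  refine Eq.trans ?_ step_last
  refine Eq.trans (congrArg _ ((congrArg _ (congrArg some hin)).trans hrun)) ?_
  rfl

end StackProg

/-! ### Functions computed by structured programs in polynomial time -/

namespace StackProg

open Function

/-- The program turns the stacks `S` into `S'` in at most `T` steps. -/
def Runs (P : StackProg) (S S' : ℕ → List Symb) (T : ℕ) : Prop := ∃ t ≤ T, Exec P S S' t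

theorem Runs.mono {P : StackProg} {S S' : ℕ → List Symb} {T T' : ℕ} (h : Runs P S S' T)
    (hT : T ≤ T') : Runs P S S' T' := by
  obtain ⟨t, ht, h⟩ := h
  exact ⟨t, ht.trans hT, h⟩

theorem Runs.congr {P : StackProg} {S S' S'' : ℕ → List Symb} {T T' : ℕ} (h : Runs P S S' T)
    (hS : S' = S'') (hT : T ≤ T') : Runs P S S'' T' := hS ▸ h.mono hT

theorem Runs.seq {P Q : StackProg} {S S' S'' : ℕ → List Symb} {a b : ℕ} (hP : Runs P S S' a)
    (hQ : Runs Q S' S'' b) : Runs (P.seq Q) S S'' (a + b + 1) := by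
  obtain ⟨t, ht, h⟩ := hP
  obtain ⟨t', ht', h'⟩ := hQ
  exact ⟨t' + t + 1, by omega, h.seq h'⟩

/-- Empty a stack. -/
def clear (k : ℕ) : StackProg := loop k fun _ => skip

/-- Move the contents of a stack onto another one, which reverses them. -/
def pour (k l : ℕ) : StackProg := loop k fun s => push l s

/-- Move the contents of the stack `k` to the empty stack `l`, by way of the empty stack `m`. -/
def bring (k l m : ℕ) : StackProg := (pour k m).seq (pour m l)

/-- Copy the contents of the stack `k` to the empty stack `l`, by way of the empty stack `m`. -/
def copy (k l m : ℕ) : StackProg := (pour k m).seq (loop m fun s => (push k s).seq (push l s))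

theorem runs_clear (k : ℕ) (S : ℕ → List Symb) :
    Runs (clear k) S (update S k []) (2 * (S k).length + 1) := by
  generalize hw : S k = w
  induction w generalizing S with
  | nil =>
    have : update S k [] = S := by rw [← hw, update_eq_self]
    rw [this]
    exact ⟨1, by simp, Exec.loop_nil hw⟩
  | cons s r ih =>
    obtain ⟨t, ht, h⟩ := ih (update S k r) (by simp)
    refine ⟨t + 1 + 1, by simp; omega, Exec.loop_cons hw (Exec.skip _) ?_⟩
    rwa [update_idem] at h

theorem runs_pour {k l : ℕ} (hkl : k ≠ l) (S : ℕ → List Symb) :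
    Runs (pour k l) S (update (update S k []) l ((S k).reverse ++ S l))
      (2 * (S k).length + 1) := by
  generalize hw : S k = w
  induction w generalizing S with
  | nil =>
    have : update (update S k []) l ([].reverse ++ S l) = S := by
      rw [← hw, update_eq_self]; simp [hw]
    rw [this]
    exact ⟨1, by simp, Exec.loop_nil hw⟩
  | cons s r ih =>
    obtain ⟨t, ht, h⟩ := ih (update (update S k r) l (s :: S l)) (by simp [hkl])
    refine ⟨t + 1 + 1, by simp; omega, Exec.loop_cons hw (Exec.push _ _ _)
      (?_ : Exec (pour k l) _ _ _)⟩
    rw [update_of_ne hkl.symm]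
    convert h using 1
    funext j
    simp only [update_apply]
    split_ifs <;> simp_all

theorem runs_bring {k l m : ℕ} (hkl : k ≠ l) (hkm : k ≠ m) (hlm : l ≠ m) {S : ℕ → List Symb}
    (hl : S l = []) (hm : S m = []) :
    Runs (bring k l m) S (update (update S k []) l (S k)) (4 * (S k).length + 3) := by
  refine ((runs_pour hkm S).seq (runs_pour hlm.symm _)).congr ?_ ?_
  · funext j
    simp only [update_apply]
    split_ifs <;> simp_all
  · simp [hm]
    omega

theorem runs_copy {k l m : ℕ} (hkl : k ≠ l) (hkm : k ≠ m) (hlm : l ≠ m) {S : ℕ → List Symb}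
    (hl : S l = []) (hm : S m = []) :
    Runs (copy k l m) S (update S l (S k)) (6 * (S k).length + 3) := by
  have key : ∀ (w : List Symb) (T : ℕ → List Symb), T m = w →
      Runs (loop m fun s => (push k s).seq (push l s)) T
        (update (update (update T m []) k (w.reverse ++ T k)) l (w.reverse ++ T l))
        (4 * w.length + 1) := by
    intro w
    induction w with
    | nil =>
      intro T hT
      refine ⟨1, by simp, ?_⟩
      convert Exec.loop_nil hT using 1
      funext j
      simp only [update_apply]
      split_ifs <;> simp_all
    | cons s r ih =>
      intro T hT
      obtain ⟨t, ht, h⟩ := ih (update (update (update T m r) k (s :: T k)) l (s :: T l)) (by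
        rw [update_of_ne hlm.symm, update_of_ne hkm.symm, update_self])
      refine ⟨t + (1 + 1 + 1) + 1, by simp; omega, Exec.loop_cons hT
        ((Exec.push _ _ _).seq (Exec.push _ _ _)) ?_⟩
      rw [update_of_ne hkm, update_of_ne hkl.symm, update_of_ne hlm]
      convert h using 1
      funext j
      simp only [update_apply]
      split_ifs <;> simp_all
  refine ((runs_pour hkm S).seq (key (S k).reverse _ (by simp [hm]))).congr ?_ ?_
  · funext j
    simp only [update_apply]
    split_ifs <;> simp_all
  · simp
    omega

end StackProg

/-! ### Polynomial bounds and closure properties of polynomial time -/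

/-- `t` is bounded by a polynomial in `μ`. -/
def PolyBounded {ι : Type} (μ t : ι → ℕ) : Prop := ∃ p : Polynomial ℕ, ∀ i, t i ≤ p.eval (μ i)

namespace PolyBounded

variable {ι κ : Type} {μ s t : ι → ℕ}

theorem mono (h : PolyBounded μ t) (hst : ∀ i, s i ≤ t i) : PolyBounded μ s := by
  obtain ⟨p, hp⟩ := h
  exact ⟨p, fun i => (hst i).trans (hp i)⟩

theorem const (c : ℕ) : PolyBounded μ fun _ => c := ⟨Polynomial.C c, fun _ => by simp⟩

theorem self : PolyBounded μ μ := ⟨Polynomial.X, fun _ => by simp⟩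

theorem add (hs : PolyBounded μ s) (ht : PolyBounded μ t) : PolyBounded μ fun i => s i + t i := by
  obtain ⟨p, hp⟩ := hs
  obtain ⟨q, hq⟩ := ht
  exact ⟨p + q, fun i => by simpa using add_le_add (hp i) (hq i)⟩

theorem mul (hs : PolyBounded μ s) (ht : PolyBounded μ t) : PolyBounded μ fun i => s i * t i := by
  obtain ⟨p, hp⟩ := hs
  obtain ⟨q, hq⟩ := ht
  exact ⟨p * q, fun i => by simpa using mul_le_mul' (hp i) (hq i)⟩

theorem comp (h : PolyBounded μ t) (φ : κ → ι) :
    PolyBounded (fun x => μ (φ x)) fun x => t (φ x) := by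
  obtain ⟨p, hp⟩ := h
  exact ⟨p, fun x => hp (φ x)⟩

/-- Over the sigma type one polynomial in `μ i` bounds all terms at once, uniformly in `c`. Bounds
for each `c` separately would not suffice. -/
theorem sum {n : ι → ℕ} {f : ι → ℕ → ℕ} (hn : PolyBounded μ n)
    (hf : PolyBounded (fun x : Σ i, Fin (n i) => μ x.1) fun x => f x.1 x.2) :
    PolyBounded μ fun i => ∑ c ∈ Finset.range (n i), f i c := by
  obtain ⟨p, hp⟩ := hf
  refine (hn.mul ⟨p, fun i => le_rfl⟩).mono fun i => ?_
  refine (Finset.sum_le_card_nsmul _ _ (p.eval (μ i)) fun c hc => ?_).trans (by simp)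
  exact hp ⟨i, c, Finset.mem_range.1 hc⟩

end PolyBounded

/-- `Feasible μ V f`: in every situation `i`, the word `f i` is computed from the words `v i` with
`v ∈ V` in time polynomial in `μ i`, by a structured program that does not depend on `i`. The words
`v i` are on the stacks `pos v`, the stacks from `n` on are empty, and the result goes to the stack
`n`, without any other change. -/
def Feasible {ι : Type} (μ : ι → ℕ) (V : Set (ι → List Symb)) (f : ι → List Symb) : Prop :=
  PolyBounded μ (fun i => (f i).length) ∧
  ∀ (pos : (ι → List Symb) → ℕ) (n : ℕ), (∀ v ∈ V, pos v < n) →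
    ∃ (P : StackProg) (T : ι → ℕ), PolyBounded μ T ∧ ∀ (i : ι) (S : ℕ → List Symb),
      (∀ v ∈ V, S (pos v) = v i) → (∀ m, n ≤ m → S m = []) →
        P.Runs S (Function.update S n (f i)) (T i)

namespace Feasible

open Function StackProg

variable {ι κ : Type} {μ : ι → ℕ} {V : Set (ι → List Symb)} {f g : ι → List Symb}

theorem mono {V' : Set (ι → List Symb)} (h : Feasible μ V f) (hV : V ⊆ V') : Feasible μ V' f :=
  ⟨h.1, fun pos n hn => by
    obtain ⟨P, T, hT, hP⟩ := h.2 pos n fun v hv => hn v (hV hv)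
    exact ⟨P, T, hT, fun i S hS => hP i S fun v hv => hS v (hV hv)⟩⟩

/-- The same program works, with each variable placed where its composite with `φ` is. For the
projection of a sigma type this makes outer variables available in the body of a loop. -/
theorem lift (h : Feasible μ V f) (φ : κ → ι) :
    Feasible (fun x => μ (φ x)) ((fun v x => v (φ x)) '' V) fun x => f (φ x) :=
  ⟨h.1.comp φ, fun pos n hn => by
    obtain ⟨P, T, hT, hP⟩ := h.2 (fun v => pos fun x => v (φ x)) n fun v hv =>
      hn _ (Set.mem_image_of_mem _ hv)
    exact ⟨P, fun x => T (φ x), hT.comp φ, fun x S hS => hP (φ x) S fun v hv =>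
      hS _ (Set.mem_image_of_mem _ hv)⟩⟩

theorem var (hf : f ∈ V) (hb : PolyBounded μ fun i => (f i).length) : Feasible μ V f :=
  ⟨hb, fun pos n hn => by
    refine ⟨copy (pos f) n (n + 1), _, ((PolyBounded.const 6).mul hb).add (PolyBounded.const 3),
      fun i S hS hE => ?_⟩
    have := hn f hf
    have h := runs_copy (show pos f ≠ n by omega) (show pos f ≠ n + 1 by omega)
      (show n ≠ n + 1 by omega) (hE n le_rfl) (hE (n + 1) (by omega))
    rwa [hS f hf] at h⟩

theorem nil : Feasible μ V fun _ => [] :=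
  ⟨(PolyBounded.const 0).mono fun _ => by simp, fun _ n _ =>
    ⟨skip, fun _ => 1, PolyBounded.const 1, fun i S _ hE => by
      have : update S n [] = S := by rw [← hE n le_rfl, update_eq_self]
      rw [this]
      exact ⟨1, le_rfl, Exec.skip S⟩⟩⟩

theorem cons (s : Symb) (hf : Feasible μ V f) : Feasible μ V fun i => s :: f i :=
  ⟨(hf.1.add (PolyBounded.const 1)).mono fun _ => by simp, fun pos n hn => by
    obtain ⟨P, T, hT, hP⟩ := hf.2 pos n hn
    refine ⟨P.seq (push n s), _, (hT.add (PolyBounded.const 1)).add (PolyBounded.const 1),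
      fun i S hS hE => ?_⟩
    refine (hP i S hS hE).seq ⟨1, le_rfl, ?_⟩
    simpa using Exec.push n s (update S n (f i))⟩

theorem tail (hf : Feasible μ V f) : Feasible μ V fun i => (f i).tail :=
  ⟨hf.1.mono fun _ => by simp, fun pos n hn => by
    obtain ⟨P, T, hT, hP⟩ := hf.2 pos n hn
    refine ⟨P.seq (case n fun _ => skip), _, (hT.add (PolyBounded.const 2)).add
      (PolyBounded.const 1), fun i S hS hE => ?_⟩
    refine (hP i S hS hE).seq ⟨2, le_rfl, ?_⟩
    have := Exec.case (k := n) (b := fun _ => skip) (S := update S n (f i)) (Exec.skip _)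
    simpa using this⟩

/-- Distinction of cases by the first symbol of a word. -/
theorem casesHead {g : Option Symb → ι → List Symb} (hf : Feasible μ V f)
    (hg : ∀ o, Feasible μ V (g o)) : Feasible μ V fun i => g (f i).head? i := by
  have hsum : ∀ t : Option Symb → ι → ℕ, (∀ o, PolyBounded μ (t o)) →
      PolyBounded μ fun i => ∑ o, t o i := by
    intro t ht
    choose p hp using ht
    exact ⟨∑ o, p o, fun i => by
      rw [Polynomial.eval_finsetSum]
      exact Finset.sum_le_sum fun o _ => hp o i⟩
  have hle : ∀ (t : Option Symb → ℕ) (o : Option Symb), t o ≤ ∑ o, t o := fun t o =>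
    Finset.single_le_sum (f := t) (fun _ _ => Nat.zero_le _) (Finset.mem_univ o)
  refine ⟨(hsum _ fun o => (hg o).1).mono fun i => hle (fun o => (g o i).length) _,
    fun pos n hn => ?_⟩
  obtain ⟨P, T, hT, hP⟩ := hf.2 pos n hn
  choose Q U hU hQ using fun o => (hg o).2 pos n hn
  -- After the first symbol is popped, the rest of the word is cleared, because every branch expects
  -- the stack `n` to be empty.
  refine ⟨P.seq (case n fun o => (clear n).seq (Q o)), _, (hT.add
    (((((PolyBounded.const 2).mul hf.1).add (PolyBounded.const 1)).add (hsum U hU)).add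
    (PolyBounded.const 1) |>.add (PolyBounded.const 1))).add
    (PolyBounded.const 1), fun i S hS hE => (hP i S hS hE).seq ?_⟩
  have h1 := runs_clear n (update S n (f i).tail)
  have h2 := hQ (f i).head? i S hS hE
  rw [update_idem, show update S n [] = S by rw [← hE n le_rfl, update_eq_self]] at h1
  obtain ⟨t, ht, h⟩ := h1.seq h2
  refine ⟨t + 1, ?_, Exec.case ?_⟩
  · have := hle (fun o => U o i) (f i).head?
    simp at ht this ⊢
    omega
  · simpa using h

/-- Iteration along a word. -/
theorem loop {w : ι → List Symb} {acc : ι → ℕ → List Symb} (hw : Feasible μ V w)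
    (h0 : Feasible μ V fun i => acc i 0)
    (hb : PolyBounded (fun x : Σ i, Fin (w i).length => μ x.1) fun x => (acc x.1 x.2).length)
    (hs : Feasible (fun x : Σ i, Fin (w i).length => μ x.1)
      (insert (fun x => acc x.1 x.2) (insert (fun x => (w x.1).drop (x.2 + 1))
        ((fun v x => v x.1) '' V))) fun x => acc x.1 (x.2 + 1)) :
    Feasible μ V fun i => acc i (w i).length := by
  obtain ⟨p, hp⟩ := hb
  obtain ⟨q, hq⟩ := hs.1
  -- `hb` covers only the accumulators before a round. The last one is bounded as the output of the
  -- last round, or as the initial one if the word is empty.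
  have hlast : ∀ i, (acc i (w i).length).length ≤ (acc i 0).length + q.eval (μ i) := by
    intro i
    rcases Nat.eq_zero_or_pos (w i).length with h | h
    · rw [h]
      omega
    · have := hq ⟨i, (w i).length - 1, by omega⟩
      simp only [Nat.sub_add_cancel h] at this
      omega
  refine ⟨(h0.1.add ⟨q, fun i => le_rfl⟩).mono hlast, fun pos n hn => ?_⟩
  -- Stack `n` holds the rest of the word, `n + 1` the accumulator, `n + 2` its next value, and `n +
  -- 3` is scratch space.
  obtain ⟨Pw, Tw, hTw, hPw⟩ := hw.2 pos n hn
  obtain ⟨P0, T0, hT0, hP0⟩ := h0.2 pos (n + 1) fun v hv => (hn v hv).trans (Nat.lt_succ_self n)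
  classical
  let accF : (Σ i, Fin (w i).length) → List Symb := fun x => acc x.1 x.2
  let restF : (Σ i, Fin (w i).length) → List Symb := fun x => (w x.1).drop (x.2 + 1)
  -- Different variables may become equal as functions on the sigma type, where situations with an
  -- empty word disappear. Any of the corresponding stacks then holds the right word, so one is
  -- chosen.
  let pos' : ((Σ i, Fin (w i).length) → List Symb) → ℕ := fun u =>
    if u = accF then n + 1 else if u = restF then n else
      if h : u ∈ (fun v x => v x.1) '' V then pos h.choose else 0
  have hpos' : ∀ u ∈ (insert accF (insert restF ((fun v x => v x.1) '' V))),
      u = accF ∧ pos' u = n + 1 ∨ u = restF ∧ pos' u = n ∨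
      ∃ v ∈ V, u = (fun x => v x.1) ∧ pos' u = pos v := by
    intro u hu
    by_cases h1 : u = accF
    · exact Or.inl ⟨h1, if_pos h1⟩
    · by_cases h2 : u = restF
      · exact Or.inr (Or.inl ⟨h2, by simp only [pos', if_neg h1, if_pos h2]⟩)
      · have h3 := (hu.resolve_left h1).resolve_left h2
        exact Or.inr (Or.inr ⟨h3.choose, h3.choose_spec.1, h3.choose_spec.2.symm, by
          simp only [pos', if_neg h1, if_neg h2, dif_pos h3]⟩)
  obtain ⟨Pb, Tb, ⟨pb, hpb⟩, hPb⟩ := hs.2 pos' (n + 2) (by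
    intro u hu
    rcases hpos' u hu with ⟨_, h⟩ | ⟨_, h⟩ | ⟨v, hv, _, h⟩
    · omega
    · omega
    · have := hn v hv
      omega)
  let body : StackProg := Pb.seq ((clear (n + 1)).seq (bring (n + 2) (n + 1) (n + 3)))
  have hloop : ∀ (i : ι) (r c : ℕ), c + r = (w i).length → ∀ S : ℕ → List Symb,
      (∀ v ∈ V, S (pos v) = v i) → S n = (w i).drop c → S (n + 1) = acc i c →
      (∀ m, n + 2 ≤ m → S m = []) →
      Runs (StackProg.loop n fun _ => body) S (update (update S n []) (n + 1)
        (acc i (w i).length))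
        (r * (pb.eval (μ i) + 2 * p.eval (μ i) + 4 * q.eval (μ i) + 8) + 1) := by
    intro i r
    induction r with
    | zero =>
      intro c hc S hS hSn hSa hE
      simp only [add_zero] at hc
      subst hc
      rw [List.drop_length] at hSn
      have : update (update S n []) (n + 1) (acc i (w i).length) = S := by
        rw [← hSa, ← hSn, update_eq_self, update_eq_self]
      rw [this]
      exact ⟨1, by omega, Exec.loop_nil hSn⟩
    | succ r ih =>
      intro c hc S hS hSn hSa hE
      have hlt : c < (w i).length := by omega
      have hcons : S n = (w i)[c] :: (w i).drop (c + 1) := by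
        rw [hSn, List.drop_eq_getElem_cons hlt]
      have h1 := hPb ⟨i, c, hlt⟩ (update S n ((w i).drop (c + 1))) (by
          intro u hu
          rcases hpos' u hu with ⟨hu, h⟩ | ⟨hu, h⟩ | ⟨v, hv, hu, h⟩
          · rw [h, hu, update_of_ne (by omega), hSa]
          · rw [h, hu, update_self]
          · rw [h, hu, update_of_ne (hn v hv).ne, hS v hv]) (by
          intro m hm
          rw [update_of_ne (by omega), hE m hm])
      set S1 := update (update S n ((w i).drop (c + 1))) (n + 2) (acc i (c + 1)) with hS1
      have h2 := runs_clear (n + 1) S1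
      have h3 := runs_bring (show n + 2 ≠ n + 1 by omega) (show n + 2 ≠ n + 3 by omega)
        (show n + 1 ≠ n + 3 by omega) (S := update S1 (n + 1) []) (by simp)
        (by simp [hS1, hE])
      have hbody := h1.seq (h2.seq h3)
      have e : update (update (update S1 (n + 1) []) (n + 2) []) (n + 1)
          (update S1 (n + 1) [] (n + 2)) =
          update (update S n ((w i).drop (c + 1))) (n + 1) (acc i (c + 1)) := by
        have e2 := hE (n + 2) le_rfl
        rw [hS1]
        clear * - e2
        funext j
        simp only [update_apply]
        split_ifs <;> simp_all
      rw [e] at hbody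
      have h4 := ih (c + 1) (by omega)
        (update (update S n ((w i).drop (c + 1))) (n + 1) (acc i (c + 1))) (by
          intro v hv
          have := hn v hv
          rw [update_of_ne (by omega), update_of_ne (by omega), hS v hv]) (by
          rw [update_of_ne (by omega), update_self]) (by rw [update_self]) (by
          intro m hm
          rw [update_of_ne (by omega), update_of_ne (by omega), hE m hm])
      obtain ⟨t, ht, hex⟩ := hbody
      obtain ⟨t', ht', hex'⟩ := h4
      refine ⟨t' + t + 1, ?_, ?_⟩
      · have a1 : (S1 (n + 1)).length ≤ p.eval (μ i) := by
          rw [hS1, update_of_ne (by omega), update_of_ne (by omega), hSa]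
          exact hp ⟨i, c, hlt⟩
        have a2 : (update S1 (n + 1) [] (n + 2)).length ≤ q.eval (μ i) := by
          rw [update_of_ne (by omega), hS1, update_self]
          exact hq ⟨i, c, hlt⟩
        have a3 := hpb ⟨i, c, hlt⟩
        simp only at a3
        rw [Nat.succ_mul]
        omega
      · refine Exec.loop_cons hcons hex ?_
        convert hex' using 1
        clear * -
        funext j
        simp only [update_apply]
        split_ifs <;> rfl
  have hB : PolyBounded μ fun i => (w i).length * (pb.eval (μ i) + 2 * p.eval (μ i) +
      4 * q.eval (μ i) + 8) + 1 :=
    (hw.1.mul ⟨pb + 2 * p + 4 * q + 8, fun i => by simp⟩).add (PolyBounded.const 1)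
  -- The loop leaves `n` empty, and the final transfer puts the result there.
  refine ⟨Pw.seq (P0.seq ((StackProg.loop n fun _ => body).seq (bring (n + 1) n (n + 2)))), _,
    (hTw.add ((hT0.add ((hB.add (((PolyBounded.const 4).mul
      ((h0.1.add ⟨q, fun i => le_rfl⟩).mono hlast)).add
        (PolyBounded.const 3))).add (PolyBounded.const 1))).add (PolyBounded.const 1))).add
        (PolyBounded.const 1),
      fun i S hS hE => ?_⟩
  refine (hPw i S hS hE).seq ((hP0 i _ ?_ ?_).seq ?_)
  · intro v hv
    rw [update_of_ne (hn v hv).ne, hS v hv]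
  · intro m hm
    rw [update_of_ne (by omega), hE m (by omega)]
  · have h1 := hloop i (w i).length 0 (by simp)
      (update (update S n (w i)) (n + 1) (acc i 0)) (by
        intro v hv
        have := hn v hv
        rw [update_of_ne (by omega), update_of_ne (by omega), hS v hv]) (by simp) (by simp) (by
        intro m hm
        rw [update_of_ne (by omega), update_of_ne (by omega), hE m (by omega)])
    have h2 := runs_bring (show n + 1 ≠ n by omega) (show n + 1 ≠ n + 2 by omega)
      (show n ≠ n + 2 by omega) (S := update (update (update (update S n (w i)) (n + 1)
        (acc i 0)) n []) (n + 1) (acc i (w i).length)) (by simp) (by simp [hE])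
    refine (h1.seq h2).congr ?_ (by simp)
    have e := hE (n + 1) (by omega)
    clear * - e
    funext j
    simp only [update_apply]
    split_ifs <;> simp_all

/-- Iteration with a counter. -/
theorem iter {n : ι → ℕ} {acc : ι → ℕ → List Symb}
    (hn : Feasible μ V fun i => List.replicate (n i) Symb.one)
    (h0 : Feasible μ V fun i => acc i 0)
    (hb : PolyBounded (fun x : Σ i, Fin (n i) => μ x.1) fun x => (acc x.1 x.2).length)
    (hs : ∀ V' : Set ((Σ i, Fin (n i)) → List Symb),
      (∀ f, Feasible μ V f → Feasible (fun x : Σ i, Fin (n i) => μ x.1) V' fun x => f x.1) →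
      Feasible (fun x : Σ i, Fin (n i) => μ x.1) V'
        (fun x => List.replicate (n x.1 - 1 - x.2) Symb.one) →
      Feasible (fun x : Σ i, Fin (n i) => μ x.1) V' (fun x => acc x.1 x.2) →
      Feasible (fun x : Σ i, Fin (n i) => μ x.1) V' fun x => acc x.1 (x.2 + 1)) :
    Feasible μ V fun i => acc i (n i) := by
  obtain ⟨N, hN⟩ : ∃ N : ι → List Symb, N = fun i => List.replicate (n i) Symb.one := ⟨_, rfl⟩
  obtain rfl : n = fun i => (N i).length := by simp [hN]
  rw [← hN] at hn
  refine loop hn h0 hb (hs _ (fun f hf => (hf.lift Sigma.fst).mono ?_) (var ?_ ?_)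
    (var (Set.mem_insert _ _) hb))
  · exact (Set.subset_insert _ _).trans (Set.subset_insert _ _)
  · refine Or.inr (Or.inl ?_)
    funext x
    have : N x.1 = List.replicate (N x.1).length Symb.one := congrFun hN x.1
    refine Eq.trans ?_ (congrArg (List.drop (x.2 + 1)) this).symm
    rw [List.drop_replicate, Nat.sub_sub, add_comm]
  · refine (hn.1.comp Sigma.fst).mono fun x => ?_
    simp
    omega

end Feasible

/-! ### A library of feasible functions -/

/-- A feasible number, written in unary. -/
abbrev FeasibleNat {ι : Type} (μ : ι → ℕ) (V : Set (ι → List Symb)) (f : ι → ℕ) : Prop :=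
  Feasible μ V fun i => List.replicate (f i) Symb.one

open Classical in
/-- A feasible predicate. -/
abbrev FeasibleProp {ι : Type} (μ : ι → ℕ) (V : Set (ι → List Symb)) (p : ι → Prop) : Prop :=
  FeasibleNat μ V fun i => if p i then 1 else 0

/-- A list of numbers in unary, each followed by a separator. -/
def unaryList (l : List ℕ) : List Symb :=
  l.flatMap fun a => List.replicate a Symb.one ++ [Symb.sep]

/-- A feasible list of numbers. -/
abbrev FeasibleList {ι : Type} (μ : ι → ℕ) (V : Set (ι → List Symb)) (f : ι → List ℕ) : Prop :=
  Feasible μ V fun i => unaryList (f i)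

namespace Feasible

open Function StackProg

variable {ι : Type} {μ : ι → ℕ} {V : Set (ι → List Symb)} {f g : ι → List Symb}

theorem congr (h : Feasible μ V f) (e : ∀ i, g i = f i) : Feasible μ V g := by
  obtain rfl : g = f := funext e
  exact h

theorem nat_congr {m n : ι → ℕ} (h : FeasibleNat μ V m) (e : ∀ i, n i = m i) :
    FeasibleNat μ V n := by
  obtain rfl : n = m := funext e
  exact h

theorem const (w : List Symb) : Feasible μ V fun _ => w := by
  induction w with
  | nil => exact nil
  | cons s w ih => exact ih.cons s

theorem natConst (c : ℕ) : FeasibleNat μ V fun _ => c := const _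

theorem bounded {n : ι → ℕ} (h : FeasibleNat μ V n) : PolyBounded μ n := by
  simpa using h.1

theorem length (hf : Feasible μ V f) : FeasibleNat μ V fun i => (f i).length := by
  have hb : PolyBounded (fun x : Σ i, Fin (f i).length => μ x.1)
      fun x => (List.replicate (x.2 : ℕ) Symb.one).length :=
    (hf.1.comp Sigma.fst).mono fun x => by simp
  exact loop (acc := fun _ c => List.replicate c Symb.one) hf nil hb
    ((var (Set.mem_insert _ _) hb).cons Symb.one)

theorem drop {n : ι → ℕ} (hf : Feasible μ V f) (hn : FeasibleNat μ V n) :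
    Feasible μ V fun i => (f i).drop (n i) := by
  refine iter (acc := fun i c => (f i).drop c) hn hf ?_ fun V' hV _ ha => ?_
  · exact (hf.1.comp Sigma.fst).mono fun x => by simp
  · simpa using ha.tail

theorem sub {m n : ι → ℕ} (hm : FeasibleNat μ V m) (hn : FeasibleNat μ V n) :
    FeasibleNat μ V fun i => m i - n i := by
  simpa using drop hm hn

/-- Iteration with the number of completed rounds as a counter. -/
theorem iterate {n : ι → ℕ} {acc : ι → ℕ → List Symb} (hn : FeasibleNat μ V n)
    (h0 : Feasible μ V fun i => acc i 0)
    (hb : PolyBounded (fun x : Σ i, Fin (n i) => μ x.1) fun x => (acc x.1 x.2).length)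
    (hs : ∀ V' : Set ((Σ i, Fin (n i)) → List Symb),
      (∀ f, Feasible μ V f → Feasible (fun x : Σ i, Fin (n i) => μ x.1) V' fun x => f x.1) →
      FeasibleNat (fun x : Σ i, Fin (n i) => μ x.1) V' (fun x => x.2) →
      Feasible (fun x : Σ i, Fin (n i) => μ x.1) V' (fun x => acc x.1 x.2) →
      Feasible (fun x : Σ i, Fin (n i) => μ x.1) V' fun x => acc x.1 (x.2 + 1)) :
    Feasible μ V fun i => acc i (n i) := by
  refine iter hn h0 hb fun V' hV hr ha => hs V' hV ?_ ha
  -- `iter` provides a countdown; subtracting it from `n - 1` gives the number of completed rounds.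
  have h := sub (sub (hV _ hn) (natConst 1)) hr
  have e : (fun x : Σ i, Fin (n i) => (x.2 : ℕ)) =
      fun x : Σ i, Fin (n i) => n x.1 - 1 - (n x.1 - 1 - x.2) := by
    funext x
    have := x.2.2
    omega
  rw [e]
  exact h

theorem append (hf : Feasible μ V f) (hg : Feasible μ V g) :
    Feasible μ V fun i => f i ++ g i := by
  -- Symbols are pushed at the front, so `f` is put before `g` from its end. The countdown of `iter`
  -- is exactly the position of the symbol to be pushed.
  have h := iter (acc := fun i c => (f i).drop ((f i).length - c) ++ g i) (V := V) hf.length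
    (by simpa using hg) ?_ ?_
  · simpa using h
  · exact ((hf.1.add hg.1).comp Sigma.fst).mono fun x => by simp
  · intro V' hV hr ha
    have hd := drop (hV f hf) hr
    have h := casesHead (g := fun o x => o.elim ((f x.1).drop ((f x.1).length - x.2) ++ g x.1)
      fun s => s :: ((f x.1).drop ((f x.1).length - x.2) ++ g x.1)) hd (by
        rintro (_ | s)
        · exact ha
        · exact ha.cons s)
    convert h using 2 with x
    have hx := x.2.2
    have hlt : (f x.1).length - 1 - x.2 < (f x.1).length := by omega
    have e : (f x.1).length - (x.2 + 1) = (f x.1).length - 1 - x.2 := by omega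
    have e' : (f x.1).length - x.2 = (f x.1).length - 1 - x.2 + 1 := by omega
    rw [e, e', List.drop_eq_getElem_cons hlt]
    rfl

theorem add {m n : ι → ℕ} (hm : FeasibleNat μ V m) (hn : FeasibleNat μ V n) :
    FeasibleNat μ V fun i => m i + n i := by
  simpa [List.replicate_append_replicate] using append hm hn

theorem succ {m : ι → ℕ} (hm : FeasibleNat μ V m) : FeasibleNat μ V fun i => m i + 1 :=
  add hm (natConst 1)

/-- Concatenation of computed words. -/
theorem concat {n : ι → ℕ} {f : ι → ℕ → List Symb} (hn : FeasibleNat μ V n)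
    (hs : ∀ V' : Set ((Σ i, Fin (n i)) → List Symb),
      (∀ f, Feasible μ V f → Feasible (fun x : Σ i, Fin (n i) => μ x.1) V' fun x => f x.1) →
      FeasibleNat (fun x : Σ i, Fin (n i) => μ x.1) V' (fun x => x.2) →
      Feasible (fun x : Σ i, Fin (n i) => μ x.1) V' fun x => f x.1 x.2) :
    Feasible μ V fun i => (List.range (n i)).flatMap (f i) := by
  refine iterate (acc := fun i c => (List.range c).flatMap (f i)) hn nil ?_ fun V' hV hc ha => ?_
  -- The step hypothesis is instantiated at the largest set of variables just to extract its length
  -- bound, which controls the partial concatenations.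
  · have hf := (hs Set.univ (fun f hf => (hf.lift Sigma.fst).mono (Set.subset_univ _))
      (var (Set.mem_univ _) ((hn.1.comp Sigma.fst).mono fun x => by simp))).1
    refine ((PolyBounded.sum (f := fun i c => (f i c).length) (bounded hn) hf).comp Sigma.fst).mono fun x => ?_
    rw [List.length_flatMap]
    have : ∀ c, (List.map (fun a => (f x.1 a).length) (List.range c)).sum =
        ∑ a ∈ Finset.range c, (f x.1 a).length := fun c => by
      induction c with
      | zero => rfl
      | succ c ih => rw [List.range_succ, Finset.sum_range_succ, ← ih]; simp
    rw [this]
    exact Finset.sum_le_sum_of_subset (Finset.range_subset_range.2 x.2.2.le)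
  · simpa [List.range_succ] using append ha (hs V' hV hc)

theorem sum {n : ι → ℕ} {f : ι → ℕ → ℕ} (hn : FeasibleNat μ V n)
    (hs : ∀ V' : Set ((Σ i, Fin (n i)) → List Symb),
      (∀ f, Feasible μ V f → Feasible (fun x : Σ i, Fin (n i) => μ x.1) V' fun x => f x.1) →
      FeasibleNat (fun x : Σ i, Fin (n i) => μ x.1) V' (fun x => x.2) →
      FeasibleNat (fun x : Σ i, Fin (n i) => μ x.1) V' fun x => f x.1 x.2) :
    FeasibleNat μ V fun i => ∑ c ∈ Finset.range (n i), f i c := by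
  have h := concat (f := fun i c => List.replicate (f i c) Symb.one) hn hs
  refine h.congr fun i => ?_
  beta_reduce
  generalize n i = m
  induction m with
  | zero => rfl
  | succ m ih =>
    rw [Finset.sum_range_succ, List.range_succ, List.flatMap_append, ← ih,
      ← List.replicate_append_replicate]
    simp

theorem mul {m n : ι → ℕ} (hm : FeasibleNat μ V m) (hn : FeasibleNat μ V n) :
    FeasibleNat μ V fun i => m i * n i := by
  simpa using sum (f := fun i _ => n i) hm fun V' hV _ => hV _ hn

theorem ite {p : ι → Prop} [∀ i, Decidable (p i)] (hp : FeasibleProp μ V p)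
    (hf : Feasible μ V f) (hg : Feasible μ V g) :
    Feasible μ V fun i => if p i then f i else g i := by
  have h := casesHead (g := fun o i => o.elim (g i) fun _ => f i) hp (by
    rintro (_ | s)
    · exact hg
    · exact hf)
  convert h using 2 with i
  by_cases hi : p i <;> simp [hi]

theorem natIte {p : ι → Prop} [∀ i, Decidable (p i)] {m n : ι → ℕ} (hp : FeasibleProp μ V p)
    (hm : FeasibleNat μ V m) (hn : FeasibleNat μ V n) :
    FeasibleNat μ V fun i => if p i then m i else n i := by
  exact (ite hp hm hn).congr fun i => by by_cases h : p i <;> simp [h]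

theorem prop_congr {p q : ι → Prop} (hp : FeasibleProp μ V p) (h : ∀ i, q i ↔ p i) :
    FeasibleProp μ V q := by
  obtain rfl : q = p := funext fun i => propext (h i)
  exact hp

theorem natPos {m : ι → ℕ} (hm : FeasibleNat μ V m) : FeasibleProp μ V fun i => 0 < m i := by
  have h := casesHead (g := fun o _ => List.replicate (o.elim 0 fun _ => 1) Symb.one) hm
    fun o => natConst _
  refine h.congr fun i => ?_
  beta_reduce
  rcases Nat.eq_zero_or_pos (m i) with hi | hi
  · simp [hi]
  · rw [if_pos hi]
    obtain ⟨k, hk⟩ := Nat.exists_eq_succ_of_ne_zero hi.ne'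
    simp [hk, List.replicate_succ]

theorem lt {m n : ι → ℕ} (hm : FeasibleNat μ V m) (hn : FeasibleNat μ V n) :
    FeasibleProp μ V fun i => m i < n i :=
  (natPos (sub hn hm)).prop_congr fun _ => Nat.sub_pos_iff_lt.symm

theorem not {p : ι → Prop} (hp : FeasibleProp μ V p) : FeasibleProp μ V fun i => ¬ p i := by
  exact (sub (natConst 1) hp).nat_congr fun i => by by_cases h : p i <;> simp [h]

theorem and {p q : ι → Prop} (hp : FeasibleProp μ V p) (hq : FeasibleProp μ V q) :
    FeasibleProp μ V fun i => p i ∧ q i := by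
  exact (mul hp hq).nat_congr fun i => by
    by_cases h : p i <;> by_cases h' : q i <;> simp [h, h']

theorem le {m n : ι → ℕ} (hm : FeasibleNat μ V m) (hn : FeasibleNat μ V n) :
    FeasibleProp μ V fun i => m i ≤ n i :=
  (lt hn hm).not.prop_congr fun _ => not_lt.symm

theorem eq {m n : ι → ℕ} (hm : FeasibleNat μ V m) (hn : FeasibleNat μ V n) :
    FeasibleProp μ V fun i => m i = n i :=
  ((le hm hn).and (le hn hm)).prop_congr fun _ => le_antisymm_iff

theorem exists_lt {n : ι → ℕ} {p : ι → ℕ → Prop} (hn : FeasibleNat μ V n)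
    (hs : ∀ V' : Set ((Σ i, Fin (n i)) → List Symb),
      (∀ f, Feasible μ V f → Feasible (fun x : Σ i, Fin (n i) => μ x.1) V' fun x => f x.1) →
      FeasibleNat (fun x : Σ i, Fin (n i) => μ x.1) V' (fun x => x.2) →
      FeasibleProp (fun x : Σ i, Fin (n i) => μ x.1) V' fun x => p x.1 x.2) :
    FeasibleProp μ V fun i => ∃ c < n i, p i c := by
  classical
  refine (natPos (sum (f := fun i c => if p i c then 1 else 0) hn fun V' hV hc =>
    natIte (hs V' hV hc) (natConst 1) (natConst 0))).prop_congr fun i => ?_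
  simp [Finset.Nonempty]

theorem forall_lt {n : ι → ℕ} {p : ι → ℕ → Prop} (hn : FeasibleNat μ V n)
    (hs : ∀ V' : Set ((Σ i, Fin (n i)) → List Symb),
      (∀ f, Feasible μ V f → Feasible (fun x : Σ i, Fin (n i) => μ x.1) V' fun x => f x.1) →
      FeasibleNat (fun x : Σ i, Fin (n i) => μ x.1) V' (fun x => x.2) →
      FeasibleProp (fun x : Σ i, Fin (n i) => μ x.1) V' fun x => p x.1 x.2) :
    FeasibleProp μ V fun i => ∀ c < n i, p i c :=
  (exists_lt (p := fun i c => ¬ p i c) hn fun V' hV hc => (hs V' hV hc).not).not.prop_congr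
    fun i => by push Not; rfl

theorem dvd {m n : ι → ℕ} (hm : FeasibleNat μ V m) (hn : FeasibleNat μ V n) :
    FeasibleProp μ V fun i => m i ∣ n i := by
  refine (exists_lt (p := fun i c => n i = m i * c) (succ hn) fun V' hV hc =>
    eq (hV _ hn) (mul (hV _ hm) hc)).prop_congr fun i => ⟨fun h => ?_, fun ⟨c, _, h⟩ => ⟨c, h⟩⟩
  obtain ⟨c, hc⟩ := h
  rcases Nat.eq_zero_or_pos (m i) with h0 | h0
  · exact ⟨0, Nat.succ_pos _, by simp [hc, h0]⟩
  · exact ⟨c, Nat.lt_succ_of_le (hc ▸ Nat.le_mul_of_pos_left c h0), hc⟩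

theorem min {m n : ι → ℕ} (hm : FeasibleNat μ V m) (hn : FeasibleNat μ V n) :
    FeasibleNat μ V fun i => min (m i) (n i) :=
  natIte (le hm hn) hm hn

theorem head_eq (s : Symb) (hf : Feasible μ V f) :
    FeasibleProp μ V fun i => (f i).head? = some s := by
  have h := casesHead (g := fun o _ => List.replicate (if o = some s then 1 else 0) Symb.one) hf
    fun o => natConst _
  exact h.congr fun i => by beta_reduce; congr

theorem getElem_eq {n : ι → ℕ} (s : Symb) (hf : Feasible μ V f) (hn : FeasibleNat μ V n) :
    FeasibleProp μ V fun i => (f i)[n i]? = some s :=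
  (head_eq s (drop hf hn)).prop_congr fun i => by rw [List.head?_drop]

end Feasible

/-! ### Fields of words and lists of numbers in unary -/

/-- The part of a word before the first occurrence of `s`, and so on. -/
def field (s : Symb) : ℕ → List Symb → List Symb
  | _, [] => []
  | 0, a :: w => if a = s then [] else a :: field s 0 w
  | j + 1, a :: w => if a = s then field s j w else field s (j + 1) w

theorem field_zero_append {s : Symb} {u : List Symb} (hu : s ∉ u) (v : List Symb) :
    field s 0 (u ++ s :: v) = u := by
  induction u with
  | nil => simp [field]
  | cons a u ih =>
    rw [List.mem_cons, not_or] at hu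
    simp [field, Ne.symm hu.1, ih hu.2]

theorem field_succ_append {s : Symb} {u : List Symb} (hu : s ∉ u) (j : ℕ) (v : List Symb) :
    field s (j + 1) (u ++ s :: v) = field s j v := by
  induction u with
  | nil => simp [field]
  | cons a u ih =>
    rw [List.mem_cons, not_or] at hu
    simp [field, Ne.symm hu.1, ih hu.2]

/-- A symbol belongs to the field `j` exactly when `j` separators precede it and it is none itself.
Such a test at each position is covered by `concat`. -/
theorem field_eq_flatMap (s : Symb) (j : ℕ) (w : List Symb) :
    field s j w = (List.range w.length).flatMap fun c =>
      if (w.take c).count s = j ∧ w[c]? ≠ some s then (w.drop c).take 1 else [] := by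
  induction w generalizing j with
  | nil => cases j <;> rfl
  | cons a w ih =>
    rw [List.length_cons, List.range_succ_eq_map, List.flatMap_cons, List.flatMap_map]
    by_cases ha : a = s
    · subst ha
      cases j with
      | zero => simp [field]
      | succ j => simp [field, ih]
    · cases j with
      | zero => simp [field, ih, ha]
      | succ j => simp [field, ih, ha]

theorem count_take (s : Symb) (w : List Symb) (c : ℕ) :
    (w.take c).count s = ∑ a ∈ Finset.range c, if w[a]? = some s then 1 else 0 := by
  induction c with
  | zero => simp
  | succ c ih =>
    rw [Finset.sum_range_succ, ← ih, List.take_add_one, List.count_append]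
    congr 1
    cases h : w[c]? with
    | none => simp
    | some a => by_cases ha : a = s <;> simp [ha]

namespace Feasible

variable {ι : Type} {μ : ι → ℕ} {V : Set (ι → List Symb)} {f g : ι → List Symb}

theorem count_take {n : ι → ℕ} (s : Symb) (hf : Feasible μ V f) (hn : FeasibleNat μ V n) :
    FeasibleNat μ V fun i => ((f i).take (n i)).count s := by
  simp only [_root_.count_take]
  exact sum (f := fun i a => if (f i)[a]? = some s then 1 else 0) hn fun V' hV hc =>
    natIte (getElem_eq s (hV _ hf) hc) (natConst 1) (natConst 0)

theorem field {j : ι → ℕ} (s : Symb) (hj : FeasibleNat μ V j) (hf : Feasible μ V f) :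
    Feasible μ V fun i => field s (j i) (f i) := by
  simp only [field_eq_flatMap]
  refine concat (f := fun i c => if ((f i).take c).count s = j i ∧ (f i)[c]? ≠ some s then
    ((f i).drop c).take 1 else []) hf.length fun V' hV hc => ite ?_ ?_ nil
  · exact (eq (count_take s (hV _ hf) hc) (hV _ hj)).and (getElem_eq s (hV _ hf) hc).not
  · have h := casesHead (g := fun o _ => o.toList) (drop (hV _ hf) hc) fun o => const _
    convert h using 2 with x
    cases (f x.1).drop x.2 <;> simp

end Feasible

theorem unaryList_append (l l' : List ℕ) : unaryList (l ++ l') = unaryList l ++ unaryList l' :=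
  List.flatMap_append

theorem unaryList_singleton (a : ℕ) :
    unaryList [a] = List.replicate a Symb.one ++ [Symb.sep] := by
  simp [unaryList]

theorem length_unaryList (l : List ℕ) : (unaryList l).length = l.sum + l.length := by
  induction l with
  | nil => rfl
  | cons a l ih => simp [unaryList] at ih ⊢; omega

theorem count_unaryList (l : List ℕ) : (unaryList l).count Symb.sep = l.length := by
  induction l with
  | nil => rfl
  | cons a l ih => simp [unaryList, List.count_replicate] at ih ⊢; omega

/-- Entries are the fields between separators, in unary. Beyond the list the field is empty, in
accordance with the default `0`. -/
theorem getD_eq_length_field (l : List ℕ) (j : ℕ) :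
    l.getD j 0 = (field Symb.sep j (unaryList l)).length := by
  induction l generalizing j with
  | nil => cases j <;> rfl
  | cons a l ih =>
    have e : unaryList (a :: l) = List.replicate a Symb.one ++ Symb.sep :: unaryList l := by
      simp [unaryList]
    have h : Symb.sep ∉ List.replicate a Symb.one := by simp [List.mem_replicate]
    rw [e]
    cases j with
    | zero => rw [field_zero_append h]; simp
    | succ j => rw [field_succ_append h, ← ih]; simp

namespace Feasible

variable {ι : Type} {μ : ι → ℕ} {V : Set (ι → List Symb)} {l l' : ι → List ℕ}

theorem listAppend (h : FeasibleList μ V l) (h' : FeasibleList μ V l') :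
    FeasibleList μ V fun i => l i ++ l' i := by
  exact (append h h').congr fun i => unaryList_append _ _

theorem listSingleton {n : ι → ℕ} (h : FeasibleNat μ V n) : FeasibleList μ V fun i => [n i] := by
  exact (append h (const [Symb.sep])).congr fun i => unaryList_singleton _

theorem listLength (h : FeasibleList μ V l) : FeasibleNat μ V fun i => (l i).length := by
  simpa only [List.take_length, count_unaryList] using count_take Symb.sep h h.length

theorem listGetD {n : ι → ℕ} (h : FeasibleList μ V l) (hn : FeasibleNat μ V n) :
    FeasibleNat μ V fun i => (l i).getD (n i) 0 := by
  simpa only [getD_eq_length_field] using (field Symb.sep hn h).length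

theorem listTabulate {n : ι → ℕ} {f : ι → ℕ → ℕ} (hn : FeasibleNat μ V n)
    (hs : ∀ V' : Set ((Σ i, Fin (n i)) → List Symb),
      (∀ f, Feasible μ V f → Feasible (fun x : Σ i, Fin (n i) => μ x.1) V' fun x => f x.1) →
      FeasibleNat (fun x : Σ i, Fin (n i) => μ x.1) V' (fun x => x.2) →
      FeasibleNat (fun x : Σ i, Fin (n i) => μ x.1) V' fun x => f x.1 x.2) :
    FeasibleList μ V fun i => (List.range (n i)).map (f i) := by
  have h := concat (f := fun i c => List.replicate (f i c) Symb.one ++ [Symb.sep]) hn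
    fun V' hV hc => append (hs V' hV hc) (const _)
  exact h.congr fun i => List.flatMap_map _ _ _

end Feasible

/-! ### Counting periodic points and cycles -/

namespace Dyn

open Function

theorem sumMap_iterate {α β : Type} (f : α → α) (g : β → β) (d : ℕ) :
    (Sum.map f g)^[d] = Sum.map f^[d] g^[d] := by
  induction d with
  | zero => simp
  | succ d ih => rw [iterate_succ, ih, Sum.map_comp_map, ← iterate_succ, ← iterate_succ]

/-- The number of states that return to themselves after `d` steps. -/
noncomputable def fixCountFun (d : ℕ) : Dyn → ℕ :=
  Quotient.lift (fun A : FDDS => Nat.card {x : A.State // A.map^[d] x = x}) (by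
    rintro A B ⟨e, h⟩
    refine Nat.card_congr (e.subtypeEquiv fun x => ?_)
    have hs : Function.Semiconj e A.map B.map := h
    rw [← (hs.iterate_right d).eq, e.apply_eq_iff_eq])

theorem card_sum_subtype {α β : Type} [Finite α] [Finite β] (p : α ⊕ β → Prop) :
    Nat.card {x // p x} = Nat.card {x // p (Sum.inl x)} + Nat.card {x // p (Sum.inr x)} := by
  rw [← Nat.card_sum]
  exact Nat.card_congr (Equiv.subtypeSum)

/-- The number of states that return to themselves after `d` steps, as a homomorphism. -/
noncomputable def fixCount (d : ℕ) : Dyn →+* ℕ where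
  toFun := fixCountFun d
  map_zero' := by
    show Nat.card {x : Empty // _} = 0
    simp
  map_one' := by
    exact (Nat.card_congr (Equiv.subtypeUnivEquiv fun _ => rfl)).trans
      (Nat.card_unique (α := Unit))
  map_add' a b := by
    induction a using Quotient.inductionOn with | _ A
    induction b using Quotient.inductionOn with | _ B
    have := A.finite
    have := B.finite
    show Nat.card {x : A.State ⊕ B.State // (Sum.map A.map B.map)^[d] x = x} =
      Nat.card {x // A.map^[d] x = x} + Nat.card {x // B.map^[d] x = x}
    rw [card_sum_subtype]
    simp [sumMap_iterate]
  map_mul' a b := by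
    induction a using Quotient.inductionOn with | _ A
    induction b using Quotient.inductionOn with | _ B
    show Nat.card {x : A.State × B.State // (Prod.map A.map B.map)^[d] x = x} =
      Nat.card {x // A.map^[d] x = x} * Nat.card {x // B.map^[d] x = x}
    rw [← Nat.card_prod]
    refine Nat.card_congr (Equiv.trans (Equiv.subtypeEquivRight fun x => ?_)
      (Equiv.subtypeProdEquivProd))
    rw [Prod.map_iterate, Prod.ext_iff]
    rfl

theorem fixCount_zero (A : Dyn) : fixCount 0 A = A.size := by
  induction A using Quotient.inductionOn with | _ A
  show Nat.card {x : A.State // x = x} = Nat.card A.State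
  exact Nat.card_congr (Equiv.subtypeUnivEquiv fun _ => rfl)

/-- The number of states on cycles of length `c`. -/
noncomputable def cycleCount (c : ℕ) : Dyn → ℕ :=
  Quotient.lift (fun A : FDDS => Nat.card {x : A.State // minimalPeriod A.map x = c}) (by
    rintro A B ⟨e, h⟩
    refine Nat.card_congr (e.subtypeEquiv fun x => ?_)
    have hs : Function.Semiconj e A.map B.map := h
    have : minimalPeriod B.map (e x) = minimalPeriod A.map x :=
      minimalPeriod_eq_minimalPeriod_iff.2 fun n => by
        simp [IsPeriodicPt, IsFixedPt, ← (hs.iterate_right n).eq]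
    rw [this])

theorem cycleCount_add (c : ℕ) (a b : Dyn) :
    cycleCount c (a + b) = cycleCount c a + cycleCount c b := by
  induction a using Quotient.inductionOn with | _ A
  induction b using Quotient.inductionOn with | _ B
  have := A.finite
  have := B.finite
  show Nat.card {x : A.State ⊕ B.State // minimalPeriod (Sum.map A.map B.map) x = c} =
    Nat.card {x // minimalPeriod A.map x = c} + Nat.card {x // minimalPeriod B.map x = c}
  have h1 : ∀ x, minimalPeriod (Sum.map A.map B.map) (Sum.inl x) = minimalPeriod A.map x :=
    fun x => minimalPeriod_eq_minimalPeriod_iff.2 fun n => by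
      simp [IsPeriodicPt, IsFixedPt, sumMap_iterate]
  have h2 : ∀ x, minimalPeriod (Sum.map A.map B.map) (Sum.inr x) = minimalPeriod B.map x :=
    fun x => minimalPeriod_eq_minimalPeriod_iff.2 fun n => by
      simp [IsPeriodicPt, IsFixedPt, sumMap_iterate]
  rw [card_sum_subtype]
  simp only [h1, h2]

theorem hasCycle_iff (A : Dyn) (p : ℕ) : A.HasCycle p ↔ 0 < p ∧ 0 < cycleCount p A := by
  induction A using Quotient.inductionOn with | _ A
  have := A.finite
  show 0 < p ∧ (∃ x, minimalPeriod A.map x = p) ↔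
    0 < p ∧ 0 < Nat.card {x // minimalPeriod A.map x = p}
  rw [Nat.card_pos_iff]
  refine and_congr_right fun _ => ⟨fun ⟨x, hx⟩ => ⟨⟨x, hx⟩, inferInstance⟩, fun h => ?_⟩
  obtain ⟨x, hx⟩ := h.1
  exact ⟨x, hx⟩

/-- A state returns after `d` steps if and only if its minimal period divides `d`. States off the
cycles have minimal period `0` and drop out since `d > 0`. -/
theorem fixCount_eq_sum (A : Dyn) {d : ℕ} (hd : 0 < d) :
    fixCount d A = ∑ c ∈ d.divisors, cycleCount c A := by
  induction A using Quotient.inductionOn with | _ A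
  have := A.finite
  classical
  have := Fintype.ofFinite A.State
  show Nat.card {x // A.map^[d] x = x} =
    ∑ c ∈ d.divisors, Nat.card {x // minimalPeriod A.map x = c}
  simp only [Nat.card_eq_fintype_card, Fintype.card_subtype]
  rw [Finset.card_eq_sum_card_fiberwise (f := minimalPeriod A.map) (t := d.divisors)]
  · refine Finset.sum_congr rfl fun c hc => ?_
    rw [Finset.filter_filter]
    congr 1
    ext x
    simp only [Finset.mem_filter, Finset.mem_univ, true_and, and_iff_right_iff_imp]
    rintro rfl
    exact isPeriodicPt_iff_minimalPeriod_dvd.2 (Nat.dvd_of_mem_divisors hc)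
  · intro x hx
    simp only [Finset.coe_filter, Finset.mem_univ, true_and, Set.mem_ofPred_eq] at hx
    exact Nat.mem_divisors.2 ⟨isPeriodicPt_iff_minimalPeriod_dvd.1 hx, hd.ne'⟩

theorem le_size_of_cycleCount {A : Dyn} {c : ℕ} (h : 0 < cycleCount c A) : c ≤ A.size := by
  induction A using Quotient.inductionOn with | _ A
  have := A.finite
  have := Fintype.ofFinite A.State
  have h : 0 < Nat.card {x // minimalPeriod A.map x = c} := h
  show c ≤ Nat.card A.State
  obtain ⟨x, rfl⟩ := (Nat.card_pos_iff.1 h).1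
  rw [Nat.card_eq_fintype_card]
  exact minimalPeriod_le_card

/-- A fixed point is fixed by every iterate. Hence a coefficient with a fixed point is positive
under all `fixCount d`, including `d = 0`, the size. -/
theorem fixCount_one_le (A : Dyn) (d : ℕ) : fixCount 1 A ≤ fixCount d A := by
  induction A using Quotient.inductionOn with | _ A
  have := A.finite
  refine Nat.card_le_card_of_injective (fun x : {x : A.State // A.map^[1] x = x} =>
    (⟨x.1, iterate_fixed x.2 d⟩ : {x : A.State // A.map^[d] x = x})) fun x y h => ?_
  exact Subtype.ext (Subtype.mk.inj h)

/-! ### Permutations -/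

theorem isPermutation_add {A B : Dyn} :
    (A + B).IsPermutation ↔ A.IsPermutation ∧ B.IsPermutation := by
  induction A using Quotient.inductionOn
  induction B using Quotient.inductionOn
  exact Sum.map_bijective

theorem isPermutation_zero : (0 : Dyn).IsPermutation := bijective_id

theorem isPermutation_one : (1 : Dyn).IsPermutation := bijective_id

theorem IsPermutation.mul {A B : Dyn} (hA : A.IsPermutation) (hB : B.IsPermutation) :
    (A * B).IsPermutation := by
  induction A using Quotient.inductionOn
  induction B using Quotient.inductionOn
  exact Bijective.prodMap hA hB

theorem isPermutation_cycle (p : ℕ) : (cycle p).IsPermutation := (finRotate p).bijective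

/-- The permutations form a subsemiring. -/
def permutations : Subsemiring Dyn where
  carrier := {A | A.IsPermutation}
  zero_mem' := isPermutation_zero
  one_mem' := isPermutation_one
  add_mem' ha hb := isPermutation_add.2 ⟨ha, hb⟩
  mul_mem' ha hb := ha.mul hb

theorem isPermutation_of_mul {A B : Dyn} (h : (A * B).IsPermutation) (hB : B.size ≠ 0) :
    A.IsPermutation := by
  induction A using Quotient.inductionOn with | _ A
  induction B using Quotient.inductionOn with | _ B
  have hB : Nat.card B.State ≠ 0 := hB
  have : Nonempty B.State := (Nat.card_pos_iff.1 (Nat.pos_of_ne_zero hB)).1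
  rcases isEmpty_or_nonempty A.State with hA | hA
  · exact ⟨fun x => (hA.false x).elim, fun x => (hA.false x).elim⟩
  · exact (Prod.map_bijective.1 (show Bijective (Prod.map A.map B.map) from h)).1

theorem size_eq_zero {A : Dyn} : A.size = 0 ↔ A = 0 := by
  constructor
  · induction A using Quotient.inductionOn with | _ A
    intro h
    have := A.finite
    have h : Nat.card A.State = 0 := h
    have hE : IsEmpty A.State := Finite.card_eq_zero_iff.1 h
    exact Quotient.sound ⟨Equiv.equivEmpty _, fun x => (hE.false x).elim⟩
  · rintro rfl
    rw [← fixCount_zero, map_zero]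

theorem isPermutation_of_pow {A : Dyn} {k : ℕ} (hk : 0 < k) (h : (A ^ k).IsPermutation) :
    A.IsPermutation := by
  by_cases hA : A = 0
  · rw [hA]
    exact isPermutation_zero
  · obtain ⟨k, rfl⟩ := Nat.exists_eq_succ_of_ne_zero hk.ne'
    rw [pow_succ'] at h
    refine isPermutation_of_mul h ?_
    rw [← fixCount_zero, map_pow, fixCount_zero]
    exact pow_ne_zero _ (mt size_eq_zero.1 hA)

theorem finRotate_iterate (q d : ℕ) (i : Fin (q + 1)) :
    ((finRotate (q + 1))^[d] i : ℕ) = (i + d) % (q + 1) := by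
  induction d with
  | zero => simp [Nat.mod_eq_of_lt i.2]
  | succ d ih =>
    rw [iterate_succ_apply', finRotate_apply, Fin.val_add, ih]
    simp [Nat.add_assoc]

theorem finRotate_iterate_eq_iff {p d : ℕ} (i : Fin p) :
    (finRotate p)^[d] i = i ↔ p ∣ d := by
  obtain ⟨q, rfl⟩ : ∃ q, p = q + 1 := ⟨p - 1, by have := i.2; omega⟩
  rw [Fin.ext_iff, finRotate_iterate]
  conv_lhs => rw [← Nat.mod_eq_of_lt i.2]
  constructor
  · intro h
    have h' : (i : ℕ) + d ≡ i + 0 [MOD q + 1] := by simpa [Nat.ModEq] using h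
    exact (Nat.modEq_zero_iff_dvd.1 (Nat.ModEq.add_left_cancel' _ h'))
  · intro h
    have := (Nat.modEq_zero_iff_dvd.2 h).add_left i
    simpa [Nat.ModEq] using this

theorem fixCount_cycle (d p : ℕ) : fixCount d (cycle p) = if p ∣ d then p else 0 := by
  show Nat.card {x : Fin p // (finRotate p)^[d] x = x} = _
  simp only [finRotate_iterate_eq_iff]
  split_ifs with h <;> simp [h]

/-- A cycle of a permutation can be split off. -/
theorem exists_eq_cycle_add {A : Dyn} (hA : A.IsPermutation) {p : ℕ} (hp : A.HasCycle p) :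
    ∃ A', A = cycle p + A' := by
  induction A using Quotient.inductionOn with | _ A
  have := A.finite
  have hf : Bijective A.map := hA
  obtain ⟨hp0, x, hx⟩ : 0 < p ∧ ∃ x, minimalPeriod A.map x = p := hp
  set f := A.map
  have hper : f^[p] x = x := hx ▸ isPeriodicPt_minimalPeriod f x
  -- The complement of the orbit is invariant: the only preimage of `f^[i] x` is `f^[i + (p - 1)]
  -- x`, which lies on the orbit even for `i = 0`.
  have hinv : ∀ y, (¬ ∃ i, f^[i] x = y) → ¬ ∃ i, f^[i] x = f y := by
    rintro y hy ⟨i, hi⟩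
    refine hy ⟨i + (p - 1), hf.1 ?_⟩
    rw [← iterate_succ_apply' f, show (i + (p - 1)).succ = i + p by omega, iterate_add_apply, hper,
      hi]
  obtain ⟨q, rfl⟩ : ∃ q, p = q + 1 := ⟨p - 1, by omega⟩
  have hmod : ∀ n, f^[n % (q + 1)] x = f^[n] x := fun n => by
    rw [← hx, iterate_mod_minimalPeriod_eq]
  suffices h : FDDS.Iso (FDDS.add ⟨Fin (q + 1), inferInstance, finRotate (q + 1)⟩
      ⟨{y // ¬ ∃ i, f^[i] x = y}, inferInstance, fun y => ⟨f y, hinv y y.2⟩⟩) A from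
    ⟨mk _, (Quotient.sound h : mk _ = mk A).symm⟩
  refine ⟨Equiv.ofBijective (Sum.elim (fun i : Fin (q + 1) => f^[(i : ℕ)] x)
      fun y => y.1) ⟨?_, ?_⟩, ?_⟩
  · rintro (i | y) (j | z) h
    · exact congrArg Sum.inl (Fin.ext (iterate_injOn_Iio_minimalPeriod (f := f) (x := x)
        (by simpa [hx] using i.2) (by simpa [hx] using j.2) h))
    · exact (z.2 ⟨i, h⟩).elim
    · exact (y.2 ⟨j, h.symm⟩).elim
    · exact congrArg Sum.inr (Subtype.ext h)
  · intro y
    by_cases hy : ∃ i, f^[i] x = y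
    · obtain ⟨i, rfl⟩ := hy
      refine ⟨Sum.inl ⟨i % (q + 1), Nat.mod_lt _ hp0⟩, hmod i⟩
    · exact ⟨Sum.inr ⟨y, hy⟩, rfl⟩
  · rintro (i | y)
    · show f^[((finRotate (q + 1) i : Fin (q + 1)) : ℕ)] x = f (f^[(i : ℕ)] x)
      have h1 := finRotate_iterate q 1 i
      rw [iterate_one] at h1
      rw [h1, hmod, iterate_succ_apply']
    · rfl

theorem IsPermutation.exists_hasCycle {A : Dyn} (hA : A.IsPermutation) (h : A ≠ 0) :
    ∃ p, A.HasCycle p := by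
  have h : A.size ≠ 0 := mt size_eq_zero.1 h
  induction A using Quotient.inductionOn with | _ A
  have := A.finite
  have h : Nat.card A.State ≠ 0 := h
  have hf : Bijective A.map := hA
  obtain ⟨x⟩ := (Nat.card_pos_iff.1 (Nat.pos_of_ne_zero h)).1
  exact ⟨minimalPeriod A.map x, minimalPeriod_pos_of_mem_periodicPts (hf.1.mem_periodicPts x), x,
    rfl⟩

theorem IsPermutation.exists_isLeast {A : Dyn} (hA : A.IsPermutation) (h : A ≠ 0) :
    ∃ p, IsLeast {q | A.HasCycle q} p := by
  classical
  have h := hA.exists_hasCycle h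
  exact ⟨Nat.find h, Nat.find_spec h, fun q hq => Nat.find_min' h hq⟩

theorem HasCycle.ne_zero {A : Dyn} {p : ℕ} (h : A.HasCycle p) : A ≠ 0 := by
  rintro rfl
  obtain ⟨h0, h⟩ := (hasCycle_iff _ _).1 h
  have := le_size_of_cycleCount h
  rw [size_eq_zero.2 rfl] at this
  omega

/-- A cycle of `A` also occurs in `B`. Splitting it off from both preserves the inequalities, and
the size of `A` decreases. -/
theorem IsPermutation.exists_add_eq {A B : Dyn} (hA : A.IsPermutation) (hB : B.IsPermutation)
    (h : ∀ c, 0 < c → cycleCount c A ≤ cycleCount c B) : ∃ D, A + D = B := by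
  induction hn : A.size using Nat.strong_induction_on generalizing A B with | _ n ih
  by_cases hA0 : A = 0
  · exact ⟨B, by rw [hA0, zero_add]⟩
  obtain ⟨p, hp⟩ := hA.exists_hasCycle hA0
  have hp' := (hasCycle_iff _ _).1 hp
  obtain ⟨A', rfl⟩ := exists_eq_cycle_add hA hp
  obtain ⟨B', rfl⟩ := exists_eq_cycle_add hB
    ((hasCycle_iff _ _).2 ⟨hp'.1, hp'.2.trans_le (h p hp'.1)⟩)
  obtain ⟨D, hD⟩ := ih A'.size (by
      rw [← hn, ← fixCount_zero, ← fixCount_zero, map_add, fixCount_cycle]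
      simp [hp'.1]) (isPermutation_add.1 hA).2 (isPermutation_add.1 hB).2 (fun c hc => by
      have := h c hc
      rw [cycleCount_add, cycleCount_add] at this
      omega) rfl
  exact ⟨D, by rw [add_assoc, hD]⟩

theorem IsPermutation.ext {A B : Dyn} (hA : A.IsPermutation) (hB : B.IsPermutation)
    (h : ∀ c, 0 < c → cycleCount c A = cycleCount c B) : A = B := by
  obtain ⟨D, rfl⟩ := hA.exists_add_eq hB fun c hc => (h c hc).le
  by_cases hD : D = 0
  · rw [hD, add_zero]
  · obtain ⟨p, hp⟩ := (isPermutation_add.1 hB).2.exists_hasCycle hD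
    have hp := (hasCycle_iff _ _).1 hp
    have := h p hp.1
    rw [cycleCount_add] at this
    omega

/-- In the divisor sum for `fixCount c`, all terms except the one for `c` itself are known by strong
induction. -/
theorem cycleCount_eq_of_fixCount_eq {A B : Dyn}
    (h : ∀ d, 0 < d → fixCount d A = fixCount d B) {c : ℕ} (hc : 0 < c) :
    cycleCount c A = cycleCount c B := by
  induction c using Nat.strong_induction_on with | _ c ih
  have := h c hc
  rw [fixCount_eq_sum A hc, fixCount_eq_sum B hc, ← Nat.cons_self_properDivisors hc.ne',
    Finset.sum_cons, Finset.sum_cons, Finset.sum_congr rfl fun e he => ?_] at this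
  · exact Nat.add_right_cancel this
  · have he := Nat.mem_properDivisors.1 he
    exact ih e he.2 (Nat.pos_of_dvd_of_pos he.1 hc)

theorem IsPermutation.ext_fixCount {A B : Dyn} (hA : A.IsPermutation) (hB : B.IsPermutation)
    (h : ∀ d, 0 < d → fixCount d A = fixCount d B) : A = B :=
  hA.ext hB fun _ hc => cycleCount_eq_of_fixCount_eq h hc

end Dyn

/-! ### Polynomials over the permutations and the greedy algorithm -/

namespace Dyn

open Function Polynomial

theorem fixCount_eval (d : ℕ) (P : Polynomial Dyn) (X : Dyn) :
    fixCount d (P.eval X) =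
      ∑ j ∈ Finset.range (P.natDegree + 1), fixCount d (P.coeff j) * fixCount d X ^ j := by
  rw [eval_eq_sum_range, map_sum]
  simp only [map_mul, map_pow]

theorem IsPermutation.eval {P : Polynomial Dyn} (hP : ∀ j, (P.coeff j).IsPermutation) {X : Dyn}
    (hX : X.IsPermutation) : (P.eval X).IsPermutation := by
  rw [eval_eq_sum_range]
  exact permutations.sum_mem fun j _ => permutations.mul_mem (hP j) (permutations.pow_mem hX j)

/-- A polynomial over the permutations some nonconstant coefficient of which has a fixed point. -/
def HasFixingCoeff (P : Polynomial Dyn) : Prop :=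
  (∀ j, (P.coeff j).IsPermutation) ∧ ∃ j, 0 < j ∧ 0 < fixCount 1 (P.coeff j)

/-- After `fixCount d`, the value is a polynomial in `fixCount d X` with natural coefficients, and
some nonconstant coefficient is positive. -/
theorem HasFixingCoeff.fixCount_lt {P : Polynomial Dyn} (hP : HasFixingCoeff P) {d : ℕ}
    {X Y : Dyn} (h : fixCount d X < fixCount d Y) :
    fixCount d (P.eval X) < fixCount d (P.eval Y) := by
  obtain ⟨-, j, hj, hc⟩ := hP
  rw [fixCount_eval, fixCount_eval]
  refine Finset.sum_lt_sum (fun i _ => Nat.mul_le_mul_left _ (Nat.pow_le_pow_left h.le i))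
    ⟨j, ?_, ?_⟩
  · refine Finset.mem_range.2 (Nat.lt_succ_of_le (le_natDegree_of_ne_zero fun h0 => ?_))
    rw [h0, map_zero] at hc
    exact hc.false
  · exact Nat.mul_lt_mul_of_pos_left (Nat.pow_lt_pow_left h hj.ne')
      (hc.trans_le (fixCount_one_le _ d))

theorem HasFixingCoeff.fixCount_congr (P : Polynomial Dyn) {d : ℕ} {X Y : Dyn}
    (h : fixCount d X = fixCount d Y) : fixCount d (P.eval X) = fixCount d (P.eval Y) := by
  rw [fixCount_eval, fixCount_eval, h]

/-- The term of degree `j` is a summand of a permutation and its coefficient is nonempty, so `X ^ j`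
is a permutation, and with `j > 0` so is `X`. Thus arbitrary solutions reduce to permutations. -/
theorem HasFixingCoeff.isPermutation {P : Polynomial Dyn} (hP : HasFixingCoeff P) {X : Dyn}
    (h : (P.eval X).IsPermutation) : X.IsPermutation := by
  obtain ⟨-, j, hj, hc⟩ := hP
  have hjd : j ∈ Finset.range (P.natDegree + 1) := by
    refine Finset.mem_range.2 (Nat.lt_succ_of_le (le_natDegree_of_ne_zero fun h0 => ?_))
    rw [h0, map_zero] at hc
    exact hc.false
  rw [eval_eq_sum_range, ← Finset.add_sum_erase _ _ hjd] at h
  have h1 := (isPermutation_add.1 h).1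
  rw [mul_comm] at h1
  refine isPermutation_of_pow hj (isPermutation_of_mul h1 ?_)
  rw [← fixCount_zero]
  exact (hc.trans_le (fixCount_one_le _ 0)).ne'

theorem IsPermutation.fixCount_pos_of_hasCycle {Z : Dyn} {p : ℕ} (h : Z.HasCycle p) :
    0 < fixCount p Z := by
  obtain ⟨h0, h⟩ := (hasCycle_iff _ _).1 h
  rw [fixCount_eq_sum Z h0]
  exact h.trans_le (Finset.single_le_sum (f := fun c => cycleCount c Z)
    (fun _ _ => Nat.zero_le _) (Nat.mem_divisors_self p h0.ne'))

/-- The length of the shortest cycle is the least positive `d` with a state that returns to itself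
after `d` steps. -/
theorem isLeast_hasCycle_iff {Z : Dyn} {p : ℕ} :
    IsLeast {q | Z.HasCycle q} p ↔ IsLeast {d | 0 < d ∧ 0 < fixCount d Z} p := by
  have key : ∀ d, 0 < d → 0 < fixCount d Z → ∃ c, Z.HasCycle c ∧ c ≤ d := by
    intro d hd h
    rw [fixCount_eq_sum Z hd, Finset.sum_pos_iff] at h
    obtain ⟨c, hc, h⟩ := h
    have hcd := Nat.dvd_of_mem_divisors hc
    exact ⟨c, (hasCycle_iff _ _).2 ⟨Nat.pos_of_dvd_of_pos hcd hd, h⟩, Nat.le_of_dvd hd hcd⟩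
  have key' : ∀ q, Z.HasCycle q → 0 < q ∧ 0 < fixCount q Z := fun q hq =>
    ⟨((hasCycle_iff _ _).1 hq).1, IsPermutation.fixCount_pos_of_hasCycle hq⟩
  constructor
  · rintro ⟨h, hl⟩
    refine ⟨key' p h, fun d hd => ?_⟩
    obtain ⟨c, hc, hcd⟩ := key d hd.1 hd.2
    exact (hl hc).trans hcd
  · rintro ⟨h, hl⟩
    obtain ⟨c, hc, hcd⟩ := key p h.1 h.2
    obtain rfl : c = p := le_antisymm hcd (hl (key' c hc))
    exact ⟨hc, fun q hq => hl (key' q hq)⟩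

/-- If `X + Z` solves the equation then the shortest cycles of `Z` and of `B - P(X)` have the same
length. -/
theorem HasFixingCoeff.isLeast_iff {P : Polynomial Dyn} (hP : HasFixingCoeff P) {X Z D : Dyn}
    (h : P.eval X + D = P.eval (X + Z)) {p : ℕ} :
    IsLeast {q | D.HasCycle q} p ↔ IsLeast {q | Z.HasCycle q} p := by
  -- By strict monotonicity, `P (X + Z)` exceeds `P X` under `fixCount d` exactly when `Z`
  -- contributes to it.
  have key : ∀ d, 0 < fixCount d D ↔ 0 < fixCount d Z := by
    intro d
    have e : fixCount d (P.eval X) + fixCount d D = fixCount d (P.eval (X + Z)) := by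
      rw [← map_add, h]
    rcases Nat.eq_zero_or_pos (fixCount d Z) with hz | hz
    · have := fixCount_congr P (d := d) (X := X) (Y := X + Z) (by rw [map_add, hz, add_zero])
      omega
    · have := hP.fixCount_lt (d := d) (X := X) (Y := X + Z) (by rw [map_add]; omega)
      omega
  simp only [isLeast_hasCycle_iff, key]

theorem HasFixingCoeff.injective {P : Polynomial Dyn} (hP : HasFixingCoeff P) {X Z : Dyn}
    (hZ : Z.IsPermutation) (h : P.eval X = P.eval (X + Z)) : Z = 0 := by
  by_contra h0
  obtain ⟨p, hp⟩ := hZ.exists_hasCycle h0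
  have h1 := IsPermutation.fixCount_pos_of_hasCycle hp
  have := hP.fixCount_lt (d := p) (X := X) (Y := X + Z) (by rw [map_add]; omega)
  rw [h] at this
  exact this.false

/-- Cycle counts can be subtracted, and a summand of a permutation is a permutation. This makes the
difference `B - F X` in a greedy step well defined. -/
theorem IsPermutation.add_left_cancel {A D D' B : Dyn} (hB : B.IsPermutation) (h : A + D = B)
    (h' : A + D' = B) : D = D' := by
  subst h
  refine (isPermutation_add.1 hB).2.ext (isPermutation_add.1 (h' ▸ hB)).2 fun c _ => ?_
  have := congrArg (cycleCount c) h'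
  rw [cycleCount_add, cycleCount_add] at this
  omega

theorem GreedyRun.eq_of_some {F : Dyn → Dyn} {B X : Dyn} {Xs : List Dyn} {r : Option Dyn}
    (h : GreedyRun F B X Xs r) : ∀ Y, r = some Y → F Y = B := by
  induction h with
  | accept X h =>
    rintro Y hY
    rwa [← Option.some.inj hY]
  | reject X h => rintro Y ⟨⟩
  | step X D p Xs r _ _ _ ih => exact ih

theorem add_ne_of_ne_zero {A D : Dyn} (hD : D ≠ 0) : A ≠ A + D := by
  intro h
  have := congrArg (fixCount 0) h
  rw [map_add, fixCount_zero D] at this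
  exact hD (size_eq_zero.1 (by omega))

theorem size_le_of_add_eq {A D B : Dyn} (h : A + D = B) : A.size ≤ B.size := by
  rw [← fixCount_zero, ← fixCount_zero, ← h, map_add]
  exact Nat.le_add_right _ _

/-- The three rules exclude each other, since the remainder in a step has a cycle and so is nonzero.
In a step both the remainder and the least cycle length are determined. -/
theorem GreedyRun.unique {F : Dyn → Dyn} {B X : Dyn} (hB : B.IsPermutation) {Xs Xs' : List Dyn}
    {r r' : Option Dyn} (h : GreedyRun F B X Xs r) (h' : GreedyRun F B X Xs' r') :
    Xs = Xs' ∧ r = r' := by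
  induction h generalizing Xs' r' with
  | accept X h =>
    cases h' with
    | accept => exact ⟨rfl, rfl⟩
    | reject _ h' =>
      rcases h' with h' | h'
      · rw [h] at h'
        exact h'.false.elim
      · exact (h' ⟨0, by rw [add_zero, h]⟩).elim
    | step _ D p _ _ hD hp _ =>
      rw [← h] at hD
      exact (add_ne_of_ne_zero hp.1.ne_zero hD.symm).elim
  | reject X h =>
    cases h' with
    | accept _ h' =>
      rcases h with h | h
      · rw [h'] at h
        exact h.false.elim
      · exact (h ⟨0, by rw [add_zero, h']⟩).elim
    | reject => exact ⟨rfl, rfl⟩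
    | step _ D p _ _ hD hp _ =>
      rcases h with h | h
      · exact (h.not_ge (size_le_of_add_eq hD)).elim
      · exact (h ⟨D, hD⟩).elim
  | step X D p Xs r hD hp hrun ih =>
    cases h' with
    | accept _ h' =>
      rw [← h'] at hD
      exact (add_ne_of_ne_zero hp.1.ne_zero hD.symm).elim
    | reject _ h' =>
      rcases h' with h' | h'
      · exact (h'.not_ge (size_le_of_add_eq hD)).elim
      · exact (h' ⟨D, hD⟩).elim
    | step _ D' p' Xs' r' hD' hp' hrun' =>
      obtain rfl := hB.add_left_cancel hD hD'
      obtain rfl := hp.unique hp'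
      obtain ⟨h1, h2⟩ := ih hrun'
      exact ⟨by rw [h1], h2⟩

theorem HasFixingCoeff.exists_run {P : Polynomial Dyn} (hP : HasFixingCoeff P) {B : Dyn}
    (hB : B.IsPermutation) (X : Dyn) :
    ∃ Xs r, GreedyRun (fun X => P.eval X) B X Xs r := by
  -- Each added cycle makes `P X` strictly larger. The `+ 1` lets the measure decrease even when `P
  -- X` already has the size of `B`.
  induction hn : B.size + 1 - (P.eval X).size using Nat.strong_induction_on generalizing X with
  | _ n ih
  by_cases h1 : P.eval X = B
  · exact ⟨_, _, GreedyRun.accept X h1⟩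
  by_cases h2 : ∃ D, P.eval X + D = B
  · obtain ⟨D, hD⟩ := h2
    have hD0 : D ≠ 0 := by
      rintro rfl
      exact h1 (by rw [← hD, add_zero])
    obtain ⟨p, hp⟩ := (isPermutation_add.1 (hD ▸ hB)).2.exists_isLeast hD0
    have hle := size_le_of_add_eq hD
    have hlt := hP.fixCount_lt (d := 0) (X := X) (Y := X + cycle p) (by
      rw [map_add, fixCount_cycle]
      simp [((hasCycle_iff _ _).1 hp.1).1])
    rw [fixCount_zero, fixCount_zero] at hlt
    obtain ⟨Xs, r, hr⟩ := ih (B.size + 1 - (P.eval (X + cycle p)).size) (by omega) _ rfl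
    exact ⟨_, _, GreedyRun.step X D p Xs r hD hp hr⟩
  · exact ⟨_, _, GreedyRun.reject X (Or.inr h2)⟩

/-- Expanding `(X + Z) ^ n` involves only additions. Hence a value that is a summand of a solution
is never rejected. -/
theorem exists_eval_add (P : Polynomial Dyn) (X Z : Dyn) : ∃ D, P.eval X + D = P.eval (X + Z) := by
  induction P using Polynomial.induction_on' with
  | add P Q hP hQ =>
    obtain ⟨D, hD⟩ := hP
    obtain ⟨E, hE⟩ := hQ
    exact ⟨D + E, by rw [eval_add, eval_add, ← hD, ← hE, add_add_add_comm]⟩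
  | monomial n a =>
    have key : ∃ D, X ^ n + D = (X + Z) ^ n := by
      induction n with
      | zero => exact ⟨0, by simp⟩
      | succ n ih =>
        obtain ⟨D, hD⟩ := ih
        exact ⟨X ^ n * Z + D * (X + Z), by rw [pow_succ (X + Z), ← hD]; ring⟩
    obtain ⟨D, hD⟩ := key
    exact ⟨a * D, by rw [eval_monomial, eval_monomial, ← hD, mul_add]⟩

/-- The invariant is that the solution is the current value plus some `Z`. A step removes from `Z` a
shortest cycle, which has the same length as a shortest cycle of the remainder. -/
theorem HasFixingCoeff.run_eq_some {P : Polynomial Dyn} (hP : HasFixingCoeff P) {B X : Dyn}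
    {Xs : List Dyn} {r : Option Dyn} (h : GreedyRun (fun X => P.eval X) B X Xs r) :
    ∀ Z : Dyn, Z.IsPermutation → P.eval (X + Z) = B → r = some (X + Z) := by
  induction h with
  | accept X h =>
    intro Z hZ hB
    rw [hP.injective hZ (h.trans hB.symm), add_zero]
  | reject X h =>
    intro Z hZ hB
    exfalso
    obtain ⟨D, hD⟩ := exists_eval_add P X Z
    rw [hB] at hD
    rcases h with h | h
    · exact h.not_ge (size_le_of_add_eq hD)
    · exact h ⟨D, hD⟩
  | step X D p Xs r hD hp _ ih =>
    intro Z hZ hB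
    have hp' := (hP.isLeast_iff (hD.trans hB.symm)).1 hp
    obtain ⟨Z', rfl⟩ := exists_eq_cycle_add hZ hp'.1
    rw [← add_assoc] at hB ⊢
    exact ih Z' (isPermutation_add.1 hZ).2 hB

/-- The greedy algorithm has exactly one run, and it solves the equation. -/
theorem HasFixingCoeff.greedy {P : Polynomial Dyn} (hP : HasFixingCoeff P) {B : Dyn}
    (hB : B.IsPermutation) :
    (∃! t : List Dyn × Option Dyn, GreedyRun (fun X => P.eval X) B 0 t.1 t.2) ∧
      ∀ (Xs : List Dyn) (r : Option Dyn), GreedyRun (fun X => P.eval X) B 0 Xs r →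
        ∀ X : Dyn, r = some X ↔ P.eval X = B := by
  refine ⟨?_, fun Xs r h X => ⟨h.eq_of_some X, fun hX => ?_⟩⟩
  · obtain ⟨Xs, r, h⟩ := hP.exists_run hB 0
    exact ⟨(Xs, r), h, fun t ht => Prod.ext_iff.2 (GreedyRun.unique hB ht h)⟩
  · have hXp := hP.isPermutation (hX.symm ▸ hB)
    simpa using hP.run_eq_some h X hXp (by rwa [zero_add])

/-! ### Injective polynomials have a fixing coefficient -/

/-- Two permutations that have the same numbers of states that return to themselves after `d`
steps, for all `d` divisible by one of `2, ..., n + 1`, but not for `d = 1`. -/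
noncomputable def separatingPair : ℕ → Dyn × Dyn
  | 0 => (1, 0)
  | n + 1 =>
    let x := (separatingPair n).1
    let y := (separatingPair n).2
    let a : Dyn := (n + 2 : ℕ)
    (x * cycle (n + 2) + a * y, a * x + y * cycle (n + 2))

theorem separatingPair_isPermutation (n : ℕ) :
    (separatingPair n).1.IsPermutation ∧ (separatingPair n).2.IsPermutation := by
  induction n with
  | zero => exact ⟨isPermutation_one, isPermutation_zero⟩
  | succ n ih =>
    have hc := isPermutation_cycle (n + 2)
    have hn := natCast_mem permutations (n + 2)
    exact ⟨isPermutation_add.2 ⟨ih.1.mul hc, IsPermutation.mul hn ih.2⟩,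
      isPermutation_add.2 ⟨IsPermutation.mul hn ih.1, ih.2.mul hc⟩⟩

/-- If `a ∣ d`, the cycle of length `a` and `a` fixed points count alike, so both entries become `a
* (x + y)`. An equality from an earlier stage persists because the recursion is symmetric in the two
entries. -/
theorem fixCount_separatingPair {n a d : ℕ} (ha : 2 ≤ a) (han : a ≤ n + 1) (had : a ∣ d) :
    fixCount d (separatingPair n).1 = fixCount d (separatingPair n).2 := by
  induction n with
  | zero => omega
  | succ n ih =>
    simp only [separatingPair, map_add, map_mul, map_natCast, fixCount_cycle]
    by_cases h : a = n + 2
    · subst h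
      simp only [had, if_true, Nat.cast_id]
      ring
    · rw [ih (by omega)]
      ring

/-- A cycle of length `n + 2` has no fixed point, so at `d = 1` the recursion only exchanges the
entries and multiplies both by `n + 2`. -/
theorem fixCount_one_separatingPair (n : ℕ) :
    fixCount 1 (separatingPair n).1 ≠ fixCount 1 (separatingPair n).2 := by
  induction n with
  | zero => simp [separatingPair]
  | succ n ih =>
    have h : ¬ n + 2 ∣ 1 := fun h => by
      have := Nat.le_of_dvd one_pos h
      omega
    simp only [separatingPair, map_add, map_mul, map_natCast, fixCount_cycle, h, if_false,
      mul_zero, zero_add, add_zero, Nat.cast_id]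
    exact fun h => ih (Nat.eq_of_mul_eq_mul_left (by omega) h).symm

/-- An injective polynomial has a nonconstant coefficient with a fixed point. -/
theorem hasFixingCoeff_of_injective {P : Polynomial Dyn} (hP : ∀ j, (P.coeff j).IsPermutation)
    (hinj : InjectiveOnPermutations P) : HasFixingCoeff P := by
  refine ⟨hP, ?_⟩
  by_contra! hfix
  -- A common bound for the lengths of all cycles in the coefficients.
  set m := ∑ j ∈ Finset.range (P.natDegree + 1), (P.coeff j).size with hm
  obtain ⟨hx, hy⟩ := separatingPair_isPermutation m
  have heq : P.eval (separatingPair m).1 = P.eval (separatingPair m).2 := by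
    refine (IsPermutation.eval hP hx).ext_fixCount (IsPermutation.eval hP hy) fun d hd => ?_
    -- In the first case the arguments agree under `fixCount d`. In the second, no nonconstant
    -- coefficient has a cycle of length dividing `d`: length `1` is excluded by assumption, the
    -- others by the choice of `m`.
    by_cases h : ∃ a, 2 ≤ a ∧ a ≤ m + 1 ∧ a ∣ d
    · obtain ⟨a, ha, ham, had⟩ := h
      exact HasFixingCoeff.fixCount_congr P (fixCount_separatingPair ha ham had)
    · rw [fixCount_eval, fixCount_eval]
      refine Finset.sum_congr rfl fun j hj => ?_
      rcases Nat.eq_zero_or_pos j with rfl | hj0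
      · simp
      · have h0 : fixCount d (P.coeff j) = 0 := by
          rw [fixCount_eq_sum _ hd]
          refine Finset.sum_eq_zero fun c hc => ?_
          by_contra hne
          have hpos := Nat.pos_of_ne_zero hne
          have hcd := Nat.dvd_of_mem_divisors hc
          have hc0 := Nat.pos_of_dvd_of_pos hcd hd
          have hc1 : c ≠ 1 := by
            rintro rfl
            have h1 := hfix j hj0
            rw [fixCount_eq_sum _ one_pos, Nat.divisors_one, Finset.sum_singleton] at h1
            omega
          refine h ⟨c, by omega, ?_, hcd⟩
          have h1 := le_size_of_cycleCount hpos
          have h2 : (P.coeff j).size ≤ m :=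
            Finset.single_le_sum (f := fun j => (P.coeff j).size) (fun _ _ => Nat.zero_le _) hj
          omega
        rw [h0, zero_mul, zero_mul]
  exact fixCount_one_separatingPair m (congrArg (fixCount 1) (hinj hx hy heq))

theorem hasFixingCoeff_X_pow {k : ℕ} (hk : 0 < k) : HasFixingCoeff (X ^ k) := by
  refine ⟨fun j => ?_, k, hk, ?_⟩
  · rw [coeff_X_pow]
    split_ifs
    · exact isPermutation_one
    · exact isPermutation_zero
  · rw [coeff_X_pow_self, map_one]
    exact one_pos

end Dyn

/-! ### The greedy algorithm on tables of successors -/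

/-- The table of the successors of the states of a graph. -/
def PermGraph.table (G : PermGraph) : List ℕ := (List.finRange G.1).map fun i => (G.2 i : ℕ)

/-- The number of states that return to themselves after `d` steps. -/
def tableFix (d : ℕ) (T : List ℕ) : ℕ :=
  ∑ i ∈ Finset.range T.length, if (fun x => T.getD x 0)^[d] i = i then 1 else 0

/-- The numbers of states on cycles of length `1, ..., n`, computed from the numbers `f d` of states
that return to themselves after `d` steps. -/
def cycleCounts (f : ℕ → ℕ) : ℕ → List ℕ
  | 0 => []
  | c + 1 => cycleCounts f c ++ [f (c + 1) -
      ∑ e ∈ Finset.range c, if e + 1 ∣ c + 1 then (cycleCounts f c).getD e 0 else 0]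

/-- The next action of the greedy algorithm, where `f` and `g` are the numbers of states of `F X`
and of `B` that return to themselves, and `n` is the size of `B`: to reject is `0`, to accept is
`1`, and to add a cycle of length `p` is `p + 1`. -/
def verdict (n : ℕ) (f g : ℕ → ℕ) : ℕ :=
  if n < f 0 ∨ ∃ c < n, (cycleCounts g n).getD c 0 < (cycleCounts f n).getD c 0 then 0
  else
    -- `q` is the number of lengths before the first disagreement. The shortest missing cycle thus
    -- has length `q + 1`, encoded as `q + 2`.
    let q := ∑ c ∈ Finset.range n,
      if ∀ e < c + 1, (cycleCounts f n).getD e 0 = (cycleCounts g n).getD e 0 then 1 else 0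
    if q = n then 1 else q + 2

/-- The numbers of states of `P(X)` that return to themselves after `d` steps, from the table of
`X`, with powers cut off at `M`. -/
def evalFix (P : PermPoly) (M : ℕ) (X : List ℕ) (d : ℕ) : ℕ :=
  ∑ j ∈ Finset.range P.length, tableFix d (P.getD j (0, ⟨0, 1⟩)).2.table *
    min M (tableFix d X ^ min M (P.getD j (0, ⟨0, 1⟩)).1)

/-- The next action of the greedy algorithm for `P(X) = B`, from the table of `X`. -/
def action (P : PermPoly) (B : PermGraph) (X : List ℕ) : ℕ :=
  verdict B.1 (evalFix P (B.1 + 1) X) fun d => tableFix d B.table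

/-- Add a cycle of length `p` to a table. -/
def extendTable (X : List ℕ) (p : ℕ) : List ℕ :=
  X ++ (List.range p).map fun e => if e + 1 = p then X.length else X.length + e + 1

/-- The table of the variable of the greedy algorithm after `t` steps. -/
def tableAt (P : PermPoly) (B : PermGraph) : ℕ → List ℕ
  | 0 => []
  | t + 1 =>
    if action P B (tableAt P B t) < 2 then tableAt P B t
    else extendTable (tableAt P B t) (action P B (tableAt P B t) - 1)

/-- Add a cycle of length `p` to a permutation. -/
def extendPerm {n : ℕ} (σ : Equiv.Perm (Fin n)) (p : ℕ) : Equiv.Perm (Fin (n + p)) :=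
  finSumFinEquiv.symm.trans ((Equiv.sumCongr σ (finRotate p)).trans finSumFinEquiv)

/-- Add a cycle of length `p` to a graph. -/
def PermGraph.extend (G : PermGraph) (p : ℕ) : PermGraph := ⟨G.1 + p, extendPerm G.2 p⟩

/-- The graph of the variable of the greedy algorithm after `t` steps. -/
def graphAt (P : PermPoly) (B : PermGraph) : ℕ → PermGraph
  | 0 => ⟨0, 1⟩
  | t + 1 =>
    if action P B (graphAt P B t).table < 2 then graphAt P B t
    else (graphAt P B t).extend (action P B (graphAt P B t).table - 1)

/-- The number of cycles that the greedy algorithm adds. -/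
def stepCount (P : PermPoly) (B : PermGraph) : ℕ :=
  ∑ t ∈ Finset.range (B.1 + 1), if 2 ≤ action P B (tableAt P B t) then 1 else 0

/-- The record of the run of the greedy algorithm. -/
def runRecord (P : PermPoly) (B : PermGraph) : RunRecord :=
  ((List.range (stepCount P B + 1)).map (graphAt P B),
    if action P B (tableAt P B (stepCount P B)) = 1 then some (graphAt P B (stepCount P B))
    else none)

/-! ### Correctness of the computation on tables -/

namespace PermGraph

theorem length_table (G : PermGraph) : G.table.length = G.1 := by simp [table]

theorem getD_table (G : PermGraph) (i : Fin G.1) : G.table.getD i 0 = G.2 i := by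
  simp [table]

theorem encodeGraph_eq (G : PermGraph) : encodeGraph G = unaryList G.table ++ [Symb.close] := by
  simp [encodeGraph, unaryList, table, List.flatMap_map]

theorem isPermutation_toDyn (G : PermGraph) : G.toDyn.IsPermutation := G.2.bijective

theorem size_toDyn (G : PermGraph) : G.toDyn.size = G.1 := Nat.card_fin G.1

theorem toDyn_extend (G : PermGraph) (p : ℕ) : (G.extend p).toDyn = G.toDyn + Dyn.cycle p := by
  refine (Quotient.sound ⟨finSumFinEquiv, fun x => ?_⟩ : Dyn.mk _ = Dyn.mk _).symm
  exact congrArg (fun y => finSumFinEquiv (Sum.map G.2 (finRotate p) y))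
    (finSumFinEquiv.symm_apply_apply x).symm

theorem extendPerm_castAdd {n : ℕ} (σ : Equiv.Perm (Fin n)) (p : ℕ) (i : Fin n) :
    extendPerm σ p (Fin.castAdd p i) = Fin.castAdd p (σ i) := by
  simp [extendPerm]

theorem extendPerm_natAdd {n : ℕ} (σ : Equiv.Perm (Fin n)) (p : ℕ) (i : Fin p) :
    extendPerm σ p (Fin.natAdd n i) = Fin.natAdd n (finRotate p i) := by
  simp [extendPerm]

theorem table_extend (G : PermGraph) (p : ℕ) : (G.extend p).table = extendTable G.table p := by
  refine List.ext_getElem (by simp [length_table, extendTable]; rfl) fun i h1 h2 => ?_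
  have hlen : i < G.1 + p := by
    rw [length_table] at h1
    exact h1
  have e1 : (G.extend p).table[i] = (extendPerm G.2 p ⟨i, hlen⟩ : ℕ) := by
    simp [table, extend]
    rfl
  rw [e1]
  simp only [extendTable]
  by_cases hi : i < G.1
  · rw [List.getElem_append_left (by rwa [length_table])]
    have : (⟨i, hlen⟩ : Fin (G.1 + p)) = Fin.castAdd p ⟨i, hi⟩ := rfl
    rw [this, extendPerm_castAdd]
    simp [table]
  · rw [List.getElem_append_right (by rw [length_table]; omega)]
    obtain ⟨e, rfl⟩ := Nat.exists_eq_add_of_le (not_lt.1 hi)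
    have he : e < p := by omega
    have : (⟨G.1 + e, hlen⟩ : Fin (G.1 + p)) = Fin.natAdd G.1 ⟨e, he⟩ := rfl
    rw [this, extendPerm_natAdd]
    obtain ⟨q, rfl⟩ : ∃ q, p = q + 1 := ⟨p - 1, by omega⟩
    simp only [Fin.val_natAdd, coe_finRotate, length_table, List.getElem_map, List.getElem_range,
      Fin.ext_iff, Fin.val_last, Nat.add_sub_cancel_left]
    split_ifs <;> omega

end PermGraph

theorem tableFix_table (d : ℕ) (G : PermGraph) :
    tableFix d G.table = Dyn.fixCount d G.toDyn := by
  have h : ∀ i : Fin G.1, (fun x => G.table.getD x 0)^[d] i = (G.2^[d] i : ℕ) := by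
    intro i
    induction d with
    | zero => rfl
    | succ d ih => rw [Function.iterate_succ_apply', Function.iterate_succ_apply', ih, G.getD_table]
  rw [tableFix, G.length_table, Finset.sum_range]
  simp only [h]
  refine Eq.trans ?_ (show Nat.card {x : Fin G.1 // G.2^[d] x = x} = _ from rfl)
  rw [Nat.card_eq_fintype_card, Fintype.card_subtype, Finset.card_filter]
  simp only [Fin.val_inj]

theorem length_cycleCounts (f : ℕ → ℕ) (n : ℕ) : (cycleCounts f n).length = n := by
  induction n with
  | zero => rfl
  | succ n ih => simp [cycleCounts, ih]

/-- The divisor sum is solved for its largest index. Entry `c` belongs to length `c + 1`, and only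
the values of `f` at `1, ..., n` matter. -/
theorem getD_cycleCounts {f : ℕ → ℕ} {n : ℕ} {A : Dyn}
    (h : ∀ d, 0 < d → d ≤ n → f d = Dyn.fixCount d A) {c : ℕ} (hc : c < n) :
    (cycleCounts f n).getD c 0 = Dyn.cycleCount (c + 1) A := by
  induction n generalizing c with
  | zero => omega
  | succ n ih =>
    have ih' : ∀ e, e < n → (cycleCounts f n).getD e 0 = Dyn.cycleCount (e + 1) A := fun e he =>
      ih (fun d hd hdn => h d hd (hdn.trans (Nat.le_succ n))) he
    rw [cycleCounts]
    rcases Nat.lt_succ_iff_lt_or_eq.1 hc with hc | rfl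
    · rw [List.getD_append _ _ _ _ (by rwa [length_cycleCounts])]
      exact ih' c hc
    · rw [List.getD_append_right _ _ _ _ (by rw [length_cycleCounts]), length_cycleCounts,
        Nat.sub_self, List.getD_cons_zero, h (c + 1) (Nat.succ_pos c) le_rfl,
        Dyn.fixCount_eq_sum A (Nat.succ_pos c), ← Nat.cons_self_properDivisors (Nat.succ_ne_zero c),
        Finset.sum_cons]
      have : ∑ e ∈ Finset.range c, (if e + 1 ∣ c + 1 then (cycleCounts f c).getD e 0 else 0) =
          ∑ e ∈ (c + 1).properDivisors, Dyn.cycleCount e A := by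
        rw [Nat.properDivisors, Finset.sum_filter, Finset.sum_Ico_eq_sum_range]
        refine Finset.sum_congr rfl fun e he => ?_
        rw [ih' e (Finset.mem_range.1 he), add_comm 1 e]
      rw [this]
      exact Nat.add_sub_cancel _ _

/-- The numbers `f` need to be correct only if `Y` is no larger than `B`, provided that `f 0`
recognizes this. That leaves room for truncated evaluation. -/
theorem verdict_spec {Y B : Dyn} (hY : Y.IsPermutation) (hB : B.IsPermutation) {n : ℕ}
    (hn : B.size = n) {f g : ℕ → ℕ} (hg : ∀ d, g d = Dyn.fixCount d B)
    (hf0 : f 0 ≤ n ↔ Y.size ≤ n) (hf : Y.size ≤ n → ∀ d, f d = Dyn.fixCount d Y) :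
    (verdict n f g = 0 ∧ (B.size < Y.size ∨ ¬ ∃ D, Y + D = B)) ∨
    (verdict n f g = 1 ∧ Y = B) ∨
    ∃ p D, 0 < p ∧ verdict n f g = p + 1 ∧ Y + D = B ∧ IsLeast {q | D.HasCycle q} p := by
  classical
  have hcg : ∀ c < n, (cycleCounts g n).getD c 0 = Dyn.cycleCount (c + 1) B := fun c hc =>
    getD_cycleCounts (fun d _ _ => hg d) hc
  by_cases h0 : n < f 0
  · refine Or.inl ⟨by rw [verdict, if_pos (Or.inl h0)], Or.inl ?_⟩
    have := mt hf0.2 h0.not_ge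
    omega
  have hYn := hf0.1 (not_lt.1 h0)
  have hcf : ∀ c < n, (cycleCounts f n).getD c 0 = Dyn.cycleCount (c + 1) Y := fun c hc =>
    getD_cycleCounts (fun d _ _ => hf hYn d) hc
  by_cases h1 : ∃ c < n, (cycleCounts g n).getD c 0 < (cycleCounts f n).getD c 0
  · refine Or.inl ⟨by rw [verdict, if_pos (Or.inr h1)], Or.inr ?_⟩
    rintro ⟨D, hD⟩
    obtain ⟨c, hc, h⟩ := h1
    rw [hcg c hc, hcf c hc, ← hD, Dyn.cycleCount_add] at h
    omega
  have hle : ∀ c, 0 < c → Dyn.cycleCount c Y ≤ Dyn.cycleCount c B := by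
    intro c hc
    by_cases hcn : c ≤ n
    · push Not at h1
      have := h1 (c - 1) (by omega)
      rw [hcg _ (by omega), hcf _ (by omega), Nat.sub_add_cancel hc] at this
      exact this
    · have : ¬ 0 < Dyn.cycleCount c Y := fun h => hcn ((Dyn.le_size_of_cycleCount h).trans hYn)
      omega
  obtain ⟨D, hD⟩ := hY.exists_add_eq hB hle
  have hdiff : ∀ c, Dyn.cycleCount c Y + Dyn.cycleCount c D = Dyn.cycleCount c B := fun c => by
    rw [← hD, Dyn.cycleCount_add]
  have hDn : D.size ≤ n := by
    have := congrArg (Dyn.fixCount 0) hD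
    rw [map_add, Dyn.fixCount_zero, Dyn.fixCount_zero, Dyn.fixCount_zero] at this
    omega
  have hv : verdict n f g = if (∑ c ∈ Finset.range n, if ∀ e < c + 1,
      (cycleCounts f n).getD e 0 = (cycleCounts g n).getD e 0 then 1 else 0) = n then 1
      else (∑ c ∈ Finset.range n, if ∀ e < c + 1,
      (cycleCounts f n).getD e 0 = (cycleCounts g n).getD e 0 then 1 else 0) + 2 := by
    rw [verdict, if_neg (not_or.2 ⟨h0, h1⟩)]
  have hiff : ∀ c ∈ Finset.range n, (if ∀ e < c + 1, (cycleCounts f n).getD e 0 =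
      (cycleCounts g n).getD e 0 then 1 else 0) =
      if ∀ e < c + 1, ¬ D.HasCycle (e + 1) then 1 else 0 := by
    intro c hc
    have hc := Finset.mem_range.1 hc
    refine if_congr (forall₂_congr fun e he => ?_) rfl rfl
    have := hdiff (e + 1)
    rw [hcf e (by omega), hcg e (by omega), Dyn.hasCycle_iff]
    omega
  rw [Finset.sum_congr rfl hiff] at hv
  by_cases hD0 : D = 0
  · refine Or.inr (Or.inl ⟨?_, by rw [← hD, hD0, add_zero]⟩)
    have : ∀ c ∈ Finset.range n, (if ∀ e < c + 1, ¬ D.HasCycle (e + 1) then 1 else 0) = 1 :=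
      fun c _ => if_pos fun e _ h => h.ne_zero hD0
    rw [hv, Finset.sum_congr rfl this]
    simp
  · obtain ⟨p, hp⟩ := (Dyn.isPermutation_add.1 (hD ▸ hB)).2.exists_isLeast hD0
    have hp' := (Dyn.hasCycle_iff _ _).1 hp.1
    have hpn := (Dyn.le_size_of_cycleCount hp'.2).trans hDn
    refine Or.inr (Or.inr ⟨p, D, hp'.1, ?_, hD, hp⟩)
    have : ∀ c ∈ Finset.range n, (if ∀ e < c + 1, ¬ D.HasCycle (e + 1) then 1 else 0) =
        if c < p - 1 then 1 else 0 := by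
      intro c _
      refine if_congr ⟨fun h => ?_, fun h e he hcyc => ?_⟩ rfl rfl
      · by_contra hcp
        exact h (p - 1) (by omega) (by rw [Nat.sub_add_cancel hp'.1]; exact hp.1)
      · have := hp.2 hcyc
        omega
    have hsum : (∑ c ∈ Finset.range n, if c < p - 1 then 1 else 0) = p - 1 := by
      rw [← Finset.card_filter, show {c ∈ Finset.range n | c < p - 1} = Finset.range (p - 1) by
        ext c; simp; omega, Finset.card_range]
    rw [hv, Finset.sum_congr rfl this, hsum, if_neg (by omega)]
    omega

/-- For `x ≥ 2` the power `x ^ M` already reaches `M`; for `x ≤ 1` only the vanishing of the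
exponent matters, and `M > 0` preserves it. -/
theorem min_pow_min {M : ℕ} (hM : 0 < M) (x k : ℕ) : min M (x ^ min M k) = min M (x ^ k) := by
  rcases le_or_gt k M with hk | hk
  · rw [min_eq_right hk]
  · rw [min_eq_left hk.le]
    rcases Nat.lt_or_ge x 2 with hx | hx
    · interval_cases x
      · rw [zero_pow hM.ne', zero_pow (by omega)]
      · rw [one_pow, one_pow]
    · have h : M ≤ x ^ M := (Nat.lt_pow_self (by omega)).le
      rw [min_eq_left h, min_eq_left (h.trans (Nat.pow_le_pow_right (by omega) hk.le))]

theorem Dyn.fixCount_le_size (d : ℕ) (A : Dyn) : fixCount d A ≤ A.size := by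
  induction A using Quotient.inductionOn with | _ A
  have := A.finite
  exact Nat.card_le_card_of_injective (fun x : {x : A.State // A.map^[d] x = x} => x.1)
    Subtype.val_injective

theorem Dyn.HasFixingCoeff.size_le {P : Polynomial Dyn} (hP : HasFixingCoeff P) (X : Dyn) :
    X.size ≤ (P.eval X).size := by
  obtain ⟨-, j, hj, hc⟩ := hP
  rw [← fixCount_zero (P.eval X), fixCount_eval, ← fixCount_zero]
  refine le_trans ?_ (Finset.single_le_sum (f := fun j => fixCount 0 (P.coeff j) *
    fixCount 0 X ^ j) (fun _ _ => Nat.zero_le _) (Finset.mem_range.2 (Nat.lt_succ_of_le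
      (Polynomial.le_natDegree_of_ne_zero (n := j) fun h0 => ?_))))
  · exact (Nat.le_self_pow hj.ne' _).trans
      (Nat.le_mul_of_pos_left _ (hc.trans_le (fixCount_one_le _ 0)))
  · rw [h0, map_zero] at hc
    exact hc.false

theorem PermPoly.isPermutation_coeff (P : PermPoly) (j : ℕ) :
    (P.toPolynomial.coeff j).IsPermutation := by
  induction P with
  | nil => exact Dyn.isPermutation_zero
  | cons m P ih =>
    have : PermPoly.toPolynomial (m :: P) =
        Polynomial.monomial m.1 m.2.toDyn + PermPoly.toPolynomial P := by
      simp [PermPoly.toPolynomial]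
    rw [this, Polynomial.coeff_add, Polynomial.coeff_monomial]
    refine Dyn.isPermutation_add.2 ⟨?_, ih⟩
    split_ifs
    · exact m.2.isPermutation_toDyn
    · exact Dyn.isPermutation_zero

theorem PermPoly.fixCount_eval (P : PermPoly) (d : ℕ) (X : Dyn) :
    Dyn.fixCount d (P.toPolynomial.eval X) = ∑ j ∈ Finset.range P.length,
      Dyn.fixCount d (P.getD j (0, ⟨0, 1⟩)).2.toDyn *
        Dyn.fixCount d X ^ (P.getD j (0, ⟨0, 1⟩)).1 := by
  induction P with
  | nil => simp [PermPoly.toPolynomial]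
  | cons m P ih =>
    have : PermPoly.toPolynomial (m :: P) =
        Polynomial.monomial m.1 m.2.toDyn + PermPoly.toPolynomial P := by
      simp [PermPoly.toPolynomial]
    rw [this, Polynomial.eval_add, map_add, ih, List.length_cons, Finset.sum_range_succ', add_comm,
      Polynomial.eval_monomial, map_mul, map_pow]
    simp

/-- If the truncated or the exact sum is at most `n`, each power with a nonzero factor is at most
`n`, below the cutoff `n + 1`, and so was not truncated. -/
theorem evalFix_eq (P : PermPoly) (n : ℕ) (G : PermGraph) (d : ℕ)
    (h : evalFix P (n + 1) G.table d ≤ n ∨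
      Dyn.fixCount d (P.toPolynomial.eval G.toDyn) ≤ n) :
    evalFix P (n + 1) G.table d = Dyn.fixCount d (P.toPolynomial.eval G.toDyn) := by
  simp only [PermPoly.fixCount_eval, evalFix, tableFix_table,
    min_pow_min (Nat.succ_pos n)] at h ⊢
  refine Finset.sum_congr rfl fun j hj => ?_
  -- A zero factor can hide an arbitrarily large power, so this case is separate.
  rcases Nat.eq_zero_or_pos (Dyn.fixCount d (P.getD j (0, ⟨0, 1⟩)).2.toDyn) with h0 | h0
  · rw [h0, zero_mul, zero_mul]
  · congr 1
    refine min_eq_right ?_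
    rcases h with h | h
    · have := (Nat.le_mul_of_pos_left _ h0).trans ((Finset.single_le_sum
        (f := fun j => Dyn.fixCount d (P.getD j (0, ⟨0, 1⟩)).2.toDyn * min (n + 1)
        (Dyn.fixCount d G.toDyn ^ (P.getD j (0, ⟨0, 1⟩)).1)) (fun _ _ => Nat.zero_le _) hj).trans h)
      rcases min_le_iff.1 this with h | h <;> omega
    · have := (Nat.le_mul_of_pos_left _ h0).trans ((Finset.single_le_sum
        (f := fun j => Dyn.fixCount d (P.getD j (0, ⟨0, 1⟩)).2.toDyn *
        Dyn.fixCount d G.toDyn ^ (P.getD j (0, ⟨0, 1⟩)).1) (fun _ _ => Nat.zero_le _) hj).trans h)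
      omega

theorem action_spec {P : PermPoly} (B G : PermGraph) :
    (action P B G.table = 0 ∧ (B.toDyn.size < (P.toPolynomial.eval G.toDyn).size ∨
      ¬ ∃ D, P.toPolynomial.eval G.toDyn + D = B.toDyn)) ∨
    (action P B G.table = 1 ∧ P.toPolynomial.eval G.toDyn = B.toDyn) ∨
    ∃ p D, 0 < p ∧ action P B G.table = p + 1 ∧ P.toPolynomial.eval G.toDyn + D = B.toDyn ∧
      IsLeast {q | D.HasCycle q} p := by
  refine verdict_spec (Dyn.IsPermutation.eval P.isPermutation_coeff G.isPermutation_toDyn)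
    B.isPermutation_toDyn B.size_toDyn (fun d => tableFix_table d B) ?_ fun h d =>
      evalFix_eq P B.1 G d (Or.inr ((Dyn.fixCount_le_size d _).trans h))
  rw [← Dyn.fixCount_zero]
  constructor
  · intro h
    rwa [← evalFix_eq P B.1 G 0 (Or.inl h)]
  · intro h
    rwa [evalFix_eq P B.1 G 0 (Or.inr h)]

theorem table_graphAt (P : PermPoly) (B : PermGraph) (t : ℕ) :
    (graphAt P B t).table = tableAt P B t := by
  induction t with
  | zero => rfl
  | succ t ih =>
    rw [graphAt, tableAt, ← ih]
    split_ifs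
    · rfl
    · exact PermGraph.table_extend _ _

/-- After `t` rounds `X` has at least `t` states, while a further round requires `|X| ≤ |P X| ≤
|B|`. -/
theorem exists_halting_step {P : PermPoly} (hP : Dyn.HasFixingCoeff P.toPolynomial) (B : PermGraph) :
    ∃ s ≤ B.1 + 1, (∀ t < s, 2 ≤ action P B (tableAt P B t)) ∧
      action P B (tableAt P B s) < 2 := by
  have hgrow : ∀ t, (∀ u < t, 2 ≤ action P B (tableAt P B u)) → t ≤ (graphAt P B t).1 := by
    intro t
    induction t with
    | zero => exact fun _ => Nat.zero_le _
    | succ t ih =>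
      intro h
      have h1 := ih fun u hu => h u (by omega)
      have h2 := h t (Nat.lt_succ_self t)
      rw [graphAt, table_graphAt, if_neg (by omega)]
      show t + 1 ≤ (graphAt P B t).1 + (action P B (tableAt P B t) - 1)
      omega
  have hhalt : ∃ t, action P B (tableAt P B t) < 2 := by
    by_contra! h
    have h1 := hgrow (B.1 + 1) fun u _ => h u
    have h2 := h (B.1 + 1)
    rw [← table_graphAt] at h2
    rcases action_spec (P := P) B (graphAt P B (B.1 + 1)) with h3 | h3 | ⟨p, D, -, -, hD, -⟩
    · omega
    · omega
    · have h4 := Dyn.size_le_of_add_eq hD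
      have h5 := hP.size_le (graphAt P B (B.1 + 1)).toDyn
      rw [PermGraph.size_toDyn] at h4 h5
      omega
  classical
  refine ⟨Nat.find hhalt, ?_, fun t ht => not_lt.1 (Nat.find_min hhalt ht), Nat.find_spec hhalt⟩
  by_contra! hlt
  have h1 := hgrow (B.1 + 1) fun u hu => not_lt.1 (Nat.find_min hhalt (hu.trans hlt))
  have h2 := not_lt.1 (Nat.find_min hhalt hlt)
  rw [← table_graphAt] at h2
  rcases action_spec (P := P) B (graphAt P B (B.1 + 1)) with h3 | h3 | ⟨p, D, -, -, hD, -⟩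
  · omega
  · omega
  · have h4 := Dyn.size_le_of_add_eq hD
    have h5 := hP.size_le (graphAt P B (B.1 + 1)).toDyn
    rw [PermGraph.size_toDyn] at h4 h5
    omega

theorem tableAt_of_action_lt {P : PermPoly} {B : PermGraph} {s : ℕ}
    (h : action P B (tableAt P B s) < 2) (r : ℕ) : tableAt P B (s + r) = tableAt P B s := by
  induction r with
  | zero => rfl
  | succ r ih => rw [← add_assoc, tableAt, ih, if_pos h]

/-- The table is stationary after halting, so the rounds that add a cycle form an initial segment,
all of it within the range of the sum. -/
theorem stepCount_eq {P : PermPoly} {B : PermGraph} {s : ℕ} (hs : s ≤ B.1 + 1)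
    (h1 : ∀ t < s, 2 ≤ action P B (tableAt P B t)) (h2 : action P B (tableAt P B s) < 2) :
    stepCount P B = s := by
  have : ∀ t ∈ Finset.range (B.1 + 1), (if 2 ≤ action P B (tableAt P B t) then 1 else 0) =
      if t < s then 1 else 0 := by
    intro t _
    refine if_congr ⟨fun h => ?_, h1 t⟩ rfl rfl
    by_contra! hst
    obtain ⟨r, rfl⟩ := Nat.exists_eq_add_of_le hst
    rw [tableAt_of_action_lt h2] at h
    omega
  rw [stepCount, Finset.sum_congr rfl this, ← Finset.card_filter,
    show {t ∈ Finset.range (B.1 + 1) | t < s} = Finset.range s by ext t; simp; omega,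
    Finset.card_range]

theorem recordsRun_runRecord {P : PermPoly} (hP : Dyn.HasFixingCoeff P.toPolynomial)
    (B : PermGraph) : RecordsRun (fun X => P.toPolynomial.eval X) B.toDyn (runRecord P B) := by
  obtain ⟨s, hs, h1, h2⟩ := exists_halting_step hP B
  have hcount := stepCount_eq hs h1 h2
  -- Induction on the number `r` of rounds still to come, because a run is built from its end.
  have key : ∀ r t, t + r = s → Dyn.GreedyRun (fun X => P.toPolynomial.eval X) B.toDyn
      (graphAt P B t).toDyn
      ((List.range' t (r + 1)).map fun t => (graphAt P B t).toDyn)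
      ((if action P B (tableAt P B s) = 1 then some (graphAt P B s) else none).map
        PermGraph.toDyn) := by
    intro r
    induction r with
    | zero =>
      rintro t rfl
      simp only [add_zero] at h2 ⊢
      rw [← table_graphAt] at h2 ⊢
      rcases action_spec (P := P) B (graphAt P B t) with ⟨h3, h4⟩ | ⟨h3, h4⟩ | ⟨p, D, hp, h3, -⟩
      · rw [h3]
        exact Dyn.GreedyRun.reject _ h4
      · rw [h3]
        exact Dyn.GreedyRun.accept _ h4
      · omega
    | succ r ih =>
      intro t ht
      have h := h1 t (by omega)
      have hnext : graphAt P B (t + 1) =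
          (graphAt P B t).extend (action P B (graphAt P B t).table - 1) := by
        rw [graphAt, if_neg (by rw [table_graphAt]; omega)]
      rw [← table_graphAt] at h
      rcases action_spec (P := P) B (graphAt P B t) with
        ⟨h3, h4⟩ | ⟨h3, h4⟩ | ⟨p, D, hp, h3, hD, hl⟩
      · omega
      · omega
      · rw [List.range'_succ, List.map_cons]
        refine Dyn.GreedyRun.step _ D p _ _ hD hl ?_
        rw [h3, Nat.add_sub_cancel] at hnext
        rw [← PermGraph.toDyn_extend, ← hnext]
        exact ih (t + 1) (by omega)
  have h0 : (graphAt P B 0).toDyn = 0 := by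
    rw [← Dyn.size_eq_zero, PermGraph.size_toDyn]
    rfl
  have h := key s 0 (zero_add s)
  rw [h0, ← List.range_eq_range'] at h
  rw [RecordsRun, runRecord, hcount, List.map_map]
  exact h

/-! ### The algorithm is feasible -/

/-- The word for a polynomial and a constant side. -/
def encodeEquation (P : PermPoly) (B : PermGraph) : List Symb :=
  encodeList (fun m : ℕ × PermGraph => encodeBinary m.1 ++ encodeGraph m.2) P ++ encodeGraph B

/-- The binary digits of a number. -/
def encodeBits (k : ℕ) : List Symb :=
  (Computability.encodeNat k).map fun b => if b then Symb.one else Symb.zero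

/-- The value of a word of binary digits. -/
def bitsValue : List Symb → ℕ
  | [] => 0
  | a :: w => (if a = Symb.one then 1 else 0) + 2 * bitsValue w

theorem bitsValue_encodeBits (k : ℕ) : bitsValue (encodeBits k) = k := by
  have hpos : ∀ n : PosNum, bitsValue ((Computability.encodePosNum n).map fun b =>
      if b then Symb.one else Symb.zero) = n := by
    intro n
    induction n with
    | one => rfl
    | bit1 n ih =>
      rw [Computability.encodePosNum, List.map_cons, bitsValue, ih, PosNum.cast_bit1]
      simp
      omega
    | bit0 n ih =>
      rw [Computability.encodePosNum, List.map_cons, bitsValue, ih, PosNum.cast_bit0]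
      simp
      omega
  have hnum : ∀ n : Num, bitsValue ((Computability.encodeNum n).map fun b =>
      if b then Symb.one else Symb.zero) = n := by
    rintro (_ | n)
    · rfl
    · exact hpos n
  exact (hnum k).trans (Num.to_of_nat k)

theorem close_notMem_encodeBits (k : ℕ) : Symb.close ∉ encodeBits k := by
  simp only [encodeBits, List.mem_map, not_exists, not_and]
  intro b _
  cases b <;> simp

theorem close_notMem_unaryList (l : List ℕ) : Symb.close ∉ unaryList l := by
  simp [unaryList, List.mem_replicate]

theorem encodeEquation_nil (B : PermGraph) :
    encodeEquation [] B = [] ++ Symb.close :: (unaryList B.table ++ Symb.close :: []) := by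
  simp [encodeEquation, encodeList, PermGraph.encodeGraph_eq]

theorem encodeEquation_cons (m : ℕ × PermGraph) (P : PermPoly) (B : PermGraph) :
    encodeEquation (m :: P) B = (Symb.mark :: encodeBits m.1) ++ Symb.close ::
      (unaryList m.2.table ++ Symb.close :: encodeEquation P B) := by
  simp [encodeEquation, encodeList, PermGraph.encodeGraph_eq, encodeBinary, encodeBits]

/-- Each monomial ends two fields, exponent and coefficient. The end marker of the list adds an
empty field before the table of `B`. -/
theorem field_encodeEquation_constant (P : PermPoly) (B : PermGraph) :
    field Symb.close (2 * P.length + 1) (encodeEquation P B) = unaryList B.table := by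
  induction P with
  | nil =>
    rw [encodeEquation_nil, List.length_nil, mul_zero, field_succ_append (by simp),
      field_zero_append (close_notMem_unaryList _)]
  | cons m P ih =>
    rw [encodeEquation_cons, List.length_cons, show 2 * (P.length + 1) + 1 =
      2 * P.length + 1 + 1 + 1 by omega, field_succ_append (by simp [close_notMem_encodeBits]),
      field_succ_append (close_notMem_unaryList _), ih]

theorem field_encodeEquation_exponent (P : PermPoly) (B : PermGraph) {j : ℕ} (hj : j < P.length) :
    field Symb.close (2 * j) (encodeEquation P B) =
      Symb.mark :: encodeBits (P.getD j (0, ⟨0, 1⟩)).1 := by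
  induction P generalizing j with
  | nil => simp at hj
  | cons m P ih =>
    rw [encodeEquation_cons]
    cases j with
    | zero =>
      rw [mul_zero, field_zero_append (by simp [close_notMem_encodeBits]), List.getD_cons_zero]
    | succ j =>
      rw [show 2 * (j + 1) = 2 * j + 1 + 1 by omega, field_succ_append
        (by simp [close_notMem_encodeBits]), field_succ_append (close_notMem_unaryList _),
        ih (Nat.lt_of_succ_lt_succ hj), List.getD_cons_succ]

theorem field_encodeEquation_coefficient (P : PermPoly) (B : PermGraph) {j : ℕ}
    (hj : j < P.length) : field Symb.close (2 * j + 1) (encodeEquation P B) =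
      unaryList (P.getD j (0, ⟨0, 1⟩)).2.table := by
  induction P generalizing j with
  | nil => simp at hj
  | cons m P ih =>
    rw [encodeEquation_cons, field_succ_append (by simp [close_notMem_encodeBits])]
    cases j with
    | zero =>
      rw [mul_zero, field_zero_append (close_notMem_unaryList _), List.getD_cons_zero]
    | succ j =>
      rw [show 2 * (j + 1) = 2 * j + 1 + 1 by omega, field_succ_append (close_notMem_unaryList _),
        ih (Nat.lt_of_succ_lt_succ hj), List.getD_cons_succ]

theorem count_mark_encodeEquation (P : PermPoly) (B : PermGraph) :
    (encodeEquation P B).count Symb.mark = P.length := by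
  have h1 : ∀ l : List ℕ, (unaryList l).count Symb.mark = 0 := fun l =>
    List.count_eq_zero.2 (by simp [unaryList, List.mem_replicate])
  have h2 : ∀ k, (encodeBits k).count Symb.mark = 0 := fun k => List.count_eq_zero.2 (by
    simp only [encodeBits, List.mem_map, not_exists, not_and]
    intro b _
    cases b <;> simp)
  induction P with
  | nil => simp [encodeEquation_nil, h1]
  | cons m P ih => simp [encodeEquation_cons, h1, h2, ih]

namespace Feasible

variable {ι : Type} {μ : ι → ℕ} {V : Set (ι → List Symb)}

/-- Horner's scheme from the most significant digit, which is last. Truncation in each round keeps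
the unary accumulator small and commutes with doubling and adding a digit. -/
theorem min_bitsValue {w : ι → List Symb} {M : ι → ℕ} (hw : Feasible μ V w)
    (hM : FeasibleNat μ V M) : FeasibleNat μ V fun i => Min.min (M i) (bitsValue (w i)) := by
  have h := iter (acc := fun i c => List.replicate (Min.min (M i)
    (bitsValue ((w i).drop ((w i).length - c)))) Symb.one) hw.length
    ((natConst (μ := μ) (V := V) 0).nat_congr fun i => by simp [bitsValue]) ?_ ?_
  · exact h.nat_congr fun i => by simp
  · exact ((bounded hM).comp Sigma.fst).mono fun x => by simp
  · intro V' hV hr ha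
    have hbit := getElem_eq Symb.one (hV _ hw) hr
    refine (min (hV _ hM) (add (natIte hbit (natConst 1) (natConst 0))
      (mul (natConst 2) ha))).nat_congr fun x => ?_
    have hx := x.2.2
    have hlt : (w x.1).length - 1 - x.2 < (w x.1).length := by omega
    have e : (w x.1).length - (x.2 + 1) = (w x.1).length - 1 - x.2 := by omega
    have e' : (w x.1).length - x.2 = (w x.1).length - 1 - x.2 + 1 := by omega
    simp only [e, e']
    rw [List.drop_eq_getElem_cons hlt, bitsValue, List.getElem?_eq_getElem hlt]
    simp only [Option.some.injEq]
    omega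

theorem tableFix {d : ι → ℕ} {T : ι → List ℕ} (hd : FeasibleNat μ V d) (hT : FeasibleList μ V T) :
    FeasibleNat μ V fun i => tableFix (d i) (T i) := by
  refine sum (f := fun i x => if (fun x => (T i).getD x 0)^[d i] x = x then 1 else 0)
    (listLength hT) fun V' hV hc => natIte (eq ?_ hc) (natConst 1) (natConst 0)
  refine iterate (ι := Σ i, Fin (T i).length) (n := fun x => d x.1)
    (acc := fun x c => List.replicate ((fun y => (T x.1).getD y 0)^[c] x.2) Symb.one)
    (hV _ hd) hc ?_ fun V'' hV' hc' ha => ?_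
  -- An iterate is the starting index, an entry of the table or the default `0`, so the encoded
  -- table bounds its length.
  · refine ((hT.1.comp fun x : Σ x : Σ i, Fin (T i).length, Fin (d x.1) => x.1.1)).mono fun x => ?_
    rw [List.length_replicate, length_unaryList]
    rcases Nat.eq_zero_or_pos (x.2 : ℕ) with h | h
    · rw [h]
      exact x.1.2.2.le.trans (Nat.le_add_left _ _)
    · obtain ⟨c, hc⟩ := Nat.exists_eq_succ_of_ne_zero h.ne'
      rw [hc, Function.iterate_succ_apply']
      generalize (fun y => (T x.1.1).getD y 0)^[c] x.1.2 = z
      rcases Nat.lt_or_ge z (T x.1.1).length with hz | hz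
      · rw [List.getD_eq_getElem _ _ hz]
        exact (List.le_sum_of_mem (List.getElem_mem hz)).trans (Nat.le_add_right _ _)
      · rw [List.getD_eq_default _ _ hz]
        exact Nat.zero_le _
  · simp only [Function.iterate_succ_apply']
    exact listGetD (hV' _ (hV _ hT)) ha

theorem cycleCounts {n : ι → ℕ} {f : ι → ℕ → ℕ} (hn : FeasibleNat μ V n)
    (hs : ∀ V' : Set ((Σ i, Fin (n i)) → List Symb),
      (∀ f, Feasible μ V f → Feasible (fun x : Σ i, Fin (n i) => μ x.1) V' fun x => f x.1) →
      FeasibleNat (fun x : Σ i, Fin (n i) => μ x.1) V' (fun x => x.2) →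
      FeasibleNat (fun x : Σ i, Fin (n i) => μ x.1) V' fun x => f x.1 (x.2 + 1)) :
    FeasibleList μ V fun i => cycleCounts (f i) (n i) := by
  refine iterate (acc := fun i c => unaryList (_root_.cycleCounts (f i) c)) hn nil ?_
    fun V' hV hc ha => ?_
  · have hf := (hs Set.univ (fun f hf => (hf.lift Sigma.fst).mono (Set.subset_univ _))
      (var (Set.mem_univ _) ((hn.1.comp Sigma.fst).mono fun x => by simp))).1
    refine ((PolyBounded.sum (f := fun i c => f i (c + 1) + 1) (bounded hn) ((hf.add
      (PolyBounded.const 1)).mono fun x => by simp)).comp Sigma.fst).mono fun x => ?_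
    refine le_trans ?_ (Finset.sum_le_sum_of_subset (Finset.range_subset_range.2 x.2.2.le))
    generalize (x.2 : ℕ) = c
    induction c with
    | zero => exact Nat.zero_le _
    | succ c ih =>
      rw [_root_.cycleCounts, unaryList_append, List.length_append, Finset.sum_range_succ,
        unaryList_singleton]
      refine Nat.add_le_add ih ?_
      simp
  · refine listAppend ha (listSingleton (sub (hs V' hV hc) ?_))
    exact sum (f := fun x e => if e + 1 ∣ x.2 + 1 then
      (_root_.cycleCounts (f x.1) x.2).getD e 0 else 0) hc fun V'' hV' he =>
        natIte (dvd (succ he) (succ (hV' _ hc))) (listGetD (hV' _ ha) he) (natConst 0)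

theorem verdict {n : ι → ℕ} {f g : ι → ℕ → ℕ} (hn : FeasibleNat μ V n)
    (h0 : FeasibleNat μ V fun i => f i 0)
    (hf : ∀ V' : Set ((Σ i, Fin (n i)) → List Symb),
      (∀ f, Feasible μ V f → Feasible (fun x : Σ i, Fin (n i) => μ x.1) V' fun x => f x.1) →
      FeasibleNat (fun x : Σ i, Fin (n i) => μ x.1) V' (fun x => x.2) →
      FeasibleNat (fun x : Σ i, Fin (n i) => μ x.1) V' fun x => f x.1 (x.2 + 1))
    (hg : ∀ V' : Set ((Σ i, Fin (n i)) → List Symb),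
      (∀ f, Feasible μ V f → Feasible (fun x : Σ i, Fin (n i) => μ x.1) V' fun x => f x.1) →
      FeasibleNat (fun x : Σ i, Fin (n i) => μ x.1) V' (fun x => x.2) →
      FeasibleNat (fun x : Σ i, Fin (n i) => μ x.1) V' fun x => g x.1 (x.2 + 1)) :
    FeasibleNat μ V fun i => verdict (n i) (f i) (g i) := by
  have hcf := cycleCounts hn hf
  have hcg := cycleCounts hn hg
  have hq : FeasibleNat μ V fun i => ∑ c ∈ Finset.range (n i),
      if ∀ e < c + 1, (_root_.cycleCounts (f i) (n i)).getD e 0 =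
        (_root_.cycleCounts (g i) (n i)).getD e 0 then 1 else 0 :=
    sum (f := fun i c => if ∀ e < c + 1, (_root_.cycleCounts (f i) (n i)).getD e 0 =
        (_root_.cycleCounts (g i) (n i)).getD e 0 then 1 else 0) hn fun V' hV hc =>
      natIte (forall_lt (p := fun x e => (_root_.cycleCounts (f x.1) (n x.1)).getD e 0 =
        (_root_.cycleCounts (g x.1) (n x.1)).getD e 0) (succ hc) fun V'' hV' he =>
          eq (listGetD (hV' _ (hV _ hcf)) he) (listGetD (hV' _ (hV _ hcg)) he))
        (natConst 1) (natConst 0)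
  have hlt : FeasibleProp μ V fun i => ∃ c < n i, (_root_.cycleCounts (g i) (n i)).getD c 0 <
      (_root_.cycleCounts (f i) (n i)).getD c 0 :=
    exists_lt (p := fun i c => (_root_.cycleCounts (g i) (n i)).getD c 0 <
      (_root_.cycleCounts (f i) (n i)).getD c 0) hn fun V' hV hc =>
        lt (listGetD (hV _ hcg) hc) (listGetD (hV _ hcf) hc)
  have hrej : FeasibleProp μ V fun i => n i < f i 0 ∨ ∃ c < n i,
      (_root_.cycleCounts (g i) (n i)).getD c 0 < (_root_.cycleCounts (f i) (n i)).getD c 0 :=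
    (((lt hn h0).not.and hlt.not).not).prop_congr fun i => by rw [not_and_or, not_not, not_not]
  exact natIte hrej (natConst 0) (natIte (eq hq hn) (natConst 1) (add hq (natConst 2)))

variable {P : ι → PermPoly} {B : ι → PermGraph} {X : ι → List ℕ}

theorem polyLength (hw : Feasible μ V fun i => encodeEquation (P i) (B i)) :
    FeasibleNat μ V fun i => (P i).length :=
  (count_take Symb.mark hw hw.length).nat_congr fun i => by
    rw [List.take_length, count_mark_encodeEquation]

theorem constantTable (hw : Feasible μ V fun i => encodeEquation (P i) (B i)) :
    FeasibleList μ V fun i => (B i).table :=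
  (field Symb.close (succ (mul (natConst 2) (polyLength hw))) hw).congr fun _ =>
    (field_encodeEquation_constant _ _).symm

theorem constantSize (hw : Feasible μ V fun i => encodeEquation (P i) (B i)) :
    FeasibleNat μ V fun i => (B i).1 :=
  (listLength (constantTable hw)).nat_congr fun i => (B i).length_table.symm

theorem coefficientTable {j : ι → ℕ} (hw : Feasible μ V fun i => encodeEquation (P i) (B i))
    (hj : FeasibleNat μ V j) (hlt : ∀ i, j i < (P i).length) :
    FeasibleList μ V fun i => ((P i).getD (j i) (0, ⟨0, 1⟩)).2.table :=
  (field Symb.close (succ (mul (natConst 2) hj)) hw).congr fun i =>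
    (field_encodeEquation_coefficient _ _ (hlt i)).symm

theorem exponent {j M : ι → ℕ} (hw : Feasible μ V fun i => encodeEquation (P i) (B i))
    (hj : FeasibleNat μ V j) (hM : FeasibleNat μ V M) (hlt : ∀ i, j i < (P i).length) :
    FeasibleNat μ V fun i => Min.min (M i) ((P i).getD (j i) (0, ⟨0, 1⟩)).1 :=
  (min_bitsValue (field Symb.close (mul (natConst 2) hj) hw).tail hM).nat_congr fun i => by
    rw [field_encodeEquation_exponent _ _ (hlt i), List.tail_cons, bitsValue_encodeBits]

/-- Truncation after every multiplication is harmless: for `x > 0`, a product whose factor has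
reached `M` still reaches `M`. -/
theorem min_pow {M x k : ι → ℕ} (hM : FeasibleNat μ V M) (hx : FeasibleNat μ V x)
    (hk : FeasibleNat μ V k) : FeasibleNat μ V fun i => Min.min (M i) (x i ^ k i) := by
  refine iterate (acc := fun i c => List.replicate (Min.min (M i) (x i ^ c)) Symb.one) hk
    ((min hM (natConst 1)).nat_congr fun i => by rw [pow_zero]) ?_ fun V' hV hc ha => ?_
  · exact ((bounded hM).comp Sigma.fst).mono fun x => by simp
  · refine (min (hV _ hM) (mul ha (hV _ hx))).nat_congr fun y => ?_
    rw [pow_succ]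
    rcases Nat.eq_zero_or_pos (x y.1) with h | h
    · simp [h]
    · rcases le_total (M y.1) (x y.1 ^ (y.2 : ℕ)) with h' | h'
      · rw [min_eq_left h', min_eq_left (h'.trans (Nat.le_mul_of_pos_right _ h)),
          min_eq_left (Nat.le_mul_of_pos_right _ h)]
      · rw [min_eq_right h']

theorem evalFix {M d : ι → ℕ} (hw : Feasible μ V fun i => encodeEquation (P i) (B i))
    (hM : FeasibleNat μ V M) (hX : FeasibleList μ V X) (hd : FeasibleNat μ V d) :
    FeasibleNat μ V fun i => evalFix (P i) (M i) (X i) (d i) := by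
  refine sum (f := fun i j => _root_.tableFix (d i) ((P i).getD j (0, ⟨0, 1⟩)).2.table *
    Min.min (M i) (_root_.tableFix (d i) (X i) ^ Min.min (M i) ((P i).getD j (0, ⟨0, 1⟩)).1))
    (polyLength hw) fun _ hV hj => ?_
  have hw' := hV _ hw
  exact mul (tableFix (hV _ hd) (coefficientTable hw' hj fun x => x.2.2))
    (min_pow (hV _ hM) (tableFix (hV _ hd) (hV _ hX)) (exponent hw' hj (hV _ hM) fun x => x.2.2))

theorem action (hw : Feasible μ V fun i => encodeEquation (P i) (B i)) (hX : FeasibleList μ V X) :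
    FeasibleNat μ V fun i => action (P i) (B i) (X i) := by
  have hn := constantSize hw
  refine verdict (f := fun i => _root_.evalFix (P i) ((B i).1 + 1) (X i))
    (g := fun i d => _root_.tableFix d (B i).table) hn
    (evalFix hw (succ hn) hX (natConst 0)) (fun V' hV hc => ?_) fun V' hV hc => ?_
  · exact evalFix (hV _ hw) (succ (hV _ hn)) (hV _ hX) (succ hc)
  · exact tableFix (succ hc) (hV _ (constantTable hw))

theorem extendTable {p : ι → ℕ} (hX : FeasibleList μ V X) (hp : FeasibleNat μ V p) :
    FeasibleList μ V fun i => extendTable (X i) (p i) :=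
  listAppend hX (listTabulate (f := fun i e => if e + 1 = p i then (X i).length
    else (X i).length + e + 1) hp fun _ hV he =>
      natIte (eq (succ he) (hV _ hp)) (listLength (hV _ hX)) (succ (add (listLength (hV _ hX)) he)))

end Feasible

/-- This bounds the added cycle without assuming that the algorithm is correct, so table sizes are
controlled for all polynomials and round numbers. -/
theorem verdict_le (n : ℕ) (f g : ℕ → ℕ) : verdict n f g ≤ n + 1 := by
  have h : (∑ c ∈ Finset.range n, if ∀ e < c + 1,
      (cycleCounts f n).getD e 0 = (cycleCounts g n).getD e 0 then 1 else 0) ≤ n :=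
    (Finset.sum_le_card_nsmul _ _ 1 fun c _ => by split_ifs <;> omega).trans (by simp)
  simp only [verdict]
  split_ifs <;> omega

theorem length_tableAt_le (P : PermPoly) (B : PermGraph) (t : ℕ) :
    (tableAt P B t).length ≤ t * B.1 := by
  induction t with
  | zero => exact Nat.zero_le _
  | succ t ih =>
    rw [tableAt, Nat.succ_mul]
    split_ifs
    · omega
    · have : action P B (tableAt P B t) ≤ B.1 + 1 := verdict_le _ _ _
      simp only [extendTable, List.length_append, List.length_map, List.length_range]
      omega

/-- The new entries are at most the old length plus `p`. Together with the length, this invariant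
bounds the table in unary. -/
theorem sum_extendTable_le (X : List ℕ) (p : ℕ) (h : X.sum ≤ X.length * X.length) :
    (extendTable X p).sum ≤ (extendTable X p).length * (extendTable X p).length := by
  have h1 : ((List.range p).map fun e => if e + 1 = p then X.length else X.length + e + 1).sum ≤
      p * (X.length + p) := by
    refine (List.sum_le_card_nsmul _ (X.length + p) ?_).trans (by simp)
    simp only [List.mem_map, List.mem_range, forall_exists_index, and_imp]
    rintro _ e he rfl
    split_ifs <;> omega
  simp only [extendTable, List.sum_append, List.length_append, List.length_map, List.length_range]
  nlinarith

theorem sum_tableAt_le (P : PermPoly) (B : PermGraph) (t : ℕ) :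
    (tableAt P B t).sum ≤ (tableAt P B t).length * (tableAt P B t).length := by
  induction t with
  | zero => exact le_rfl
  | succ t ih =>
    rw [tableAt]
    split_ifs
    · exact ih
    · exact sum_extendTable_le _ _ ih

namespace Feasible

variable {ι : Type} {μ : ι → ℕ} {V : Set (ι → List Symb)} {P : ι → PermPoly} {B : ι → PermGraph}

theorem tableAt {t : ι → ℕ} (hw : Feasible μ V fun i => encodeEquation (P i) (B i))
    (ht : FeasibleNat μ V t) : FeasibleList μ V fun i => tableAt (P i) (B i) (t i) := by
  refine iterate (acc := fun i c => unaryList (_root_.tableAt (P i) (B i) c)) ht nil ?_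
    fun V' hV hc ha => ?_
  · have hb := (bounded ht).mul (bounded (constantSize hw))
    refine (((hb.mul hb).add hb).comp Sigma.fst).mono fun x => ?_
    rw [length_unaryList]
    have h1 := sum_tableAt_le (P x.1) (B x.1) x.2
    have h2 := (length_tableAt_le (P x.1) (B x.1) x.2).trans
      (Nat.mul_le_mul_right _ x.2.2.le)
    exact Nat.add_le_add (h1.trans (Nat.mul_le_mul h2 h2)) h2
  · have hact := action (hV _ hw) ha
    refine (ite (lt hact (natConst 2)) ha
      (extendTable ha (sub hact (natConst 1)))).congr fun x => ?_
    rw [_root_.tableAt]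
    split_ifs <;> rfl

theorem stepCount (hw : Feasible μ V fun i => encodeEquation (P i) (B i)) :
    FeasibleNat μ V fun i => stepCount (P i) (B i) :=
  sum (f := fun i t => if 2 ≤ _root_.action (P i) (B i) (_root_.tableAt (P i) (B i) t) then 1
    else 0) (succ (constantSize hw)) fun _ hV hc =>
      natIte (le (natConst 2) (action (hV _ hw) (tableAt (hV _ hw) hc))) (natConst 1) (natConst 0)

theorem runRecord (hw : Feasible μ V fun i => encodeEquation (P i) (B i)) :
    Feasible μ V fun i => encodeRunRecord (runRecord (P i) (B i)) := by
  have hs := stepCount hw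
  have hlast := tableAt hw hs
  have hlist := concat (f := fun i t => Symb.mark :: (unaryList (_root_.tableAt (P i) (B i) t) ++
    [Symb.close])) (succ hs) fun V' hV hc =>
      (append (tableAt (hV _ hw) hc) (const [Symb.close])).cons Symb.mark
  have hres := ite (eq (action hw hlast) (natConst 1))
    ((append hlast (const [Symb.close])).cons Symb.one) (const [Symb.zero])
  refine (append (append hlist (const [Symb.close])) hres).congr fun i => ?_
  simp only [encodeRunRecord, _root_.runRecord, encodeList, List.flatMap_map,
    PermGraph.encodeGraph_eq, table_graphAt]
  congr 1
  by_cases h : _root_.action (P i) (B i)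
    (_root_.tableAt (P i) (B i) (_root_.stepCount (P i) (B i))) = 1
  · simp only [h, if_true, table_graphAt]
  · simp only [h, if_false]

/-- A feasible function of an input word is computed by a polynomial time machine. -/
theorem computableInPolyTime {α β : Type} {ea : α → List Symb} {eb : β → List Symb} {f : α → β}
    (h : Feasible (fun a => (ea a).length) {ea} fun a => eb (f a)) :
    Nonempty (Turing.TM2ComputableInPolyTime ea eb f) := by
  -- The input is the only variable, on stack `0`, and the output goes to stack `1`; the input is
  -- then cleared, as the halting configuration requires.
  obtain ⟨Q, T, ⟨p, hp⟩, hQ⟩ := h.2 (fun _ => 0) 1 fun _ _ => one_pos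
  refine StackProg.computableInPolyTime ea eb f (Q.seq (StackProg.clear 0))
    (p + (2 * Polynomial.X + 1) + 1) fun a => ?_
  have h1 := hQ a (Function.update (fun _ => []) 0 (ea a)) (by rintro v rfl; simp) (by
    intro m hm
    rw [Function.update_of_ne (by omega)])
  refine ((h1.mono (hp a)).seq (StackProg.runs_clear 0 _)).congr ?_ (by simp)
  funext j
  simp only [Function.update_apply]
  split_ifs <;> simp_all

end Feasible

/-! ### Roots and injective polynomial equations -/

theorem mainTheorem11 :
    -- The greedy algorithm for `X ^ k = B` has exactly one run, and it solves the equation.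
    (∀ (k : ℕ) (B : Dyn), 0 < k → B.IsPermutation →
      (∃! t : List Dyn × Option Dyn, Dyn.GreedyRun (fun X => X ^ k) B 0 t.1 t.2) ∧
      ∀ (Xs : List Dyn) (r : Option Dyn), Dyn.GreedyRun (fun X => X ^ k) B 0 Xs r →
        ∀ X : Dyn, r = some X ↔ X ^ k = B) ∧
    -- A Turing machine carries out this run in polynomial time.
    (∃ f : RootInput → RunRecord,
      (∀ i : RootInput, RecordsRun (fun X => X ^ (i.1 : ℕ)) i.2.toDyn (f i)) ∧
      Nonempty (Turing.TM2ComputableInPolyTime encodeRootInput encodeRunRecord f)) ∧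
    -- The same for `P(X) = B`, with an injective polynomial `P` over the permutations.
    (∀ (P : Polynomial Dyn) (B : Dyn), (∀ j, (P.coeff j).IsPermutation) →
      InjectiveOnPermutations P → B.IsPermutation →
      (∃! t : List Dyn × Option Dyn, Dyn.GreedyRun (fun X => P.eval X) B 0 t.1 t.2) ∧
      ∀ (Xs : List Dyn) (r : Option Dyn), Dyn.GreedyRun (fun X => P.eval X) B 0 Xs r →
        ∀ X : Dyn, r = some X ↔ P.eval X = B) ∧
    (∃ f : EquationInput → RunRecord,
      (∀ i : EquationInput,
        RecordsRun (fun X => (PermPoly.toPolynomial i.1.1).eval X) i.2.toDyn (f i)) ∧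
      Nonempty (Turing.TM2ComputableInPolyTime encodeEquationInput encodeRunRecord f)) := by
  refine ⟨fun k B hk hB => ?_, ⟨fun i => runRecord [((i.1 : ℕ), ⟨1, 1⟩)] i.2, fun i => ?_, ?_⟩,
    fun P B hP hinj hB => (Dyn.hasFixingCoeff_of_injective hP hinj).greedy hB,
    ⟨fun i => runRecord i.1.1 i.2, fun i => ?_, ?_⟩⟩
  · simpa using (Dyn.hasFixingCoeff_X_pow hk).greedy hB
  · have hiso : FDDS.Iso ⟨Fin 1, inferInstance, (1 : Equiv.Perm (Fin 1))⟩ FDDS.point :=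
      ⟨(Equiv.ofUnique (Fin 1) Unit : Fin 1 ≃ Unit), fun _ => rfl⟩
    have h1 : PermGraph.toDyn ⟨1, 1⟩ = 1 := Quotient.sound hiso
    have hP : PermPoly.toPolynomial [((i.1 : ℕ), ⟨1, 1⟩)] = Polynomial.X ^ (i.1 : ℕ) := by
      simp [PermPoly.toPolynomial, h1, Polynomial.X_pow_eq_monomial]
    have h := recordsRun_runRecord (hP ▸ Dyn.hasFixingCoeff_X_pow i.1.2) i.2
    simpa [hP] using h
  · have hv : Feasible (fun i => (encodeRootInput i).length) {encodeRootInput} encodeRootInput :=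
      Feasible.var rfl PolyBounded.self
    refine Feasible.computableInPolyTime (Feasible.runRecord ?_)
    have hw : ∀ i : RootInput, encodeRootInput i = encodeBits i.1 ++ Symb.close ::
        (unaryList i.2.table ++ Symb.close :: []) := fun i => by
      simp [encodeRootInput, encodeBinary, encodeBits, PermGraph.encodeGraph_eq]
    -- The input for a root is rewritten as the equation with one monomial. The inserted symbols end
    -- the exponent, give the table `[0]` of a fixed point, end its graph and end the list.
    have h := ((Feasible.field Symb.close (Feasible.natConst 0) hv).append
      ((Feasible.const [Symb.close, Symb.sep, Symb.close, Symb.close]).append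
      ((Feasible.field Symb.close (Feasible.natConst 1) hv).append
        (Feasible.const [Symb.close])))).cons Symb.mark
    refine h.congr fun i => ?_
    rw [hw, field_zero_append (close_notMem_encodeBits _), field_succ_append
      (close_notMem_encodeBits _), field_zero_append (close_notMem_unaryList _),
      encodeEquation_cons, encodeEquation_nil]
    have : PermGraph.table ⟨1, 1⟩ = [0] := rfl
    simp [this, unaryList]
  · exact recordsRun_runRecord (Dyn.hasFixingCoeff_of_injective
      (PermPoly.isPermutation_coeff i.1.1) i.1.2) i.2
  · exact Feasible.computableInPolyTime (Feasible.runRecord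
      (Feasible.var (V := {encodeEquationInput}) rfl PolyBounded.self))
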